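/- Let $m\ge 1$ and let $K\subset\mathbb{R}^m$ be a convex body, i.e. a compact convex set with non-empty interior. For an affine hyperplane $H\subset\mathbb{R}^m$ that meets $\operatorname{int}K$, let $m(H)$ denote the center of mass of the $(m-1)$-dimensional convex body $K\cap H$ in $H$ (with respect to Lebesgue measure on $H$), and let $s(H)$ denote the Steiner point of $K\cap H$ in $H$, i.e. the center of mass of the Gaussian curvature measure of the relative boundary of $K\cap H$: the measure assigning to a Borel set $B$ the spherical measure of the set of unit vectors parallel to $H$ that are outer normals of $K\cap H$ at some point of $B$. (If $m=1$, then $H$ is a point and $m(H)=s(H)=H$.) A continuous map $f\colon X\to Y$ admits a $k$-multiplicity if there are $k$ pairwise distinct points $x_1,\dots,x_k\in X$ with $f(x_1)=\dots=f(x_k)$. (1) There is a continuous map $f_K\colon \mathbb{RP}^m\to S^m$ such that, for every $k$, if $f_K$ admits a $k$-multiplicity, then there exist $k$ pairwise distinct affine hyperplanes $H_1,\dots,H_k$, each meeting $\operatorname{int}K$, with $m(H_1)=\dots=m(H_k)$. Likewise, there is a continuous map $f_K\colon \mathbb{RP}^m\to S^m$ with the same property for Steiner points, i.e. with the conclusion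 $s(H_1)=\dots=s(H_k)$. (2) If $0\in\operatorname{int}K$, there is a continuous map $f_K\colon\mathbb{RP}^{m-1}\to\mathbb{R}^m$ such that, for every $k$, if $f_K$ admits a $k$-multiplicity, then there exist $k$ pairwise distinct linear hyperplanes $H_1,\dots,H_k$ with $m(H_1)=\dots=m(H_k)$. Likewise, there is a continuous map $f_K\colon\mathbb{RP}^{m-1}\to\mathbb{R}^m$ with the same property and the conclusion $s(H_1)=\dots=s(H_k)$. -/

import Mathlib

open MeasureTheory Module
open scoped RealInnerProductSpace

noncomputable section

/-- The topology of a real projective space: the quotient topology from the nonzero vectors. -/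
instance projectivizationTopology (V : Type*) [AddCommGroup V] [Module ℝ V]
    [TopologicalSpace V] : TopologicalSpace (Projectivization ℝ V) :=
  TopologicalSpace.coinduced (Projectivization.mk' ℝ (V := V)) inferInstance

/-- `RPOf n` is the projective space of lines through the origin of `ℝⁿ`; its dimension
is `n - 1`. -/
abbrev RPOf (n : ℕ) : Type := Projectivization ℝ (EuclideanSpace ℝ (Fin n))

/-- `UnitSphereOf n` is the unit sphere of `ℝⁿ`; its dimension is `n - 1`. -/
abbrev UnitSphereOf (n : ℕ) : Type := Metric.sphere (0 : EuclideanSpace ℝ (Fin n)) 1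

/-- A map admits a `k`-multiplicity if it takes one value at `k` pairwise distinct points. -/
def AdmitsMultiplicity {X Y : Type*} (f : X → Y) (k : ℕ) : Prop :=
  ∃ x : Fin k → X, Function.Injective x ∧ ∀ i j, f (x i) = f (x j)

variable {V : Type*} [NormedAddCommGroup V] [InnerProductSpace ℝ V]

/-- Affine hyperplanes: nonempty affine subspaces of codimension one. -/
def IsAffineHyperplane (H : AffineSubspace ℝ V) : Prop :=
  (H : Set V).Nonempty ∧ finrank ℝ H.direction + 1 = finrank ℝ V

/-- Linear hyperplanes: affine hyperplanes through the origin. -/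
def IsLinearHyperplane (H : AffineSubspace ℝ V) : Prop :=
  IsAffineHyperplane H ∧ (0 : V) ∈ H

/-- `x` is a point of `C` at which the linear functional `⟪u, ·⟫` attains its maximum on `C`,
that is, `u` is an outer normal vector of `C` at `x`. -/
def IsSupportPoint (C : Set V) (u x : V) : Prop :=
  x ∈ C ∧ ∀ y ∈ C, ⟪u, y⟫ ≤ ⟪u, x⟫

/-- Some point of `C` with outer normal vector `u`. For a convex body `C` in an affine subspace
`H`, this point is unique for almost all unit vectors `u` of the direction of `H`. -/
def supportPoint (C : Set V) (u : V) : V :=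
  Classical.epsilon (IsSupportPoint C u)

variable [FiniteDimensional ℝ V] [MeasurableSpace V] [BorelSpace V]

/-- The center of mass of a (finite, nonzero) mass distribution `μ` on `V`. -/
def centerOfMass (μ : Measure V) : V := ⨍ x, x ∂μ

/-- The Lebesgue measure of the affine subspace `H`, restricted to `K ∩ H`. -/
def sectionVolume (K : Set V) (H : AffineSubspace ℝ V) : Measure V :=
  (Measure.euclideanHausdorffMeasure (finrank ℝ H.direction)).restrict (K ∩ H)

/-- The Gaussian curvature of the relative boundary of a convex body `C` in the affine subspace
`H`, as a measure: the measure of a Borel set `B` is the spherical Lebesgue measure of the set of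
unit vectors of the direction of `H` that are outer normals of `C` at a point of `B`. Almost
every unit vector is an outer normal at exactly one point of `C`, so this is the image of
the spherical measure under `u ↦ supportPoint C u`; if the boundary is smooth, with
curvature `κ`, it is `κ` times the surface measure. If `H` is a point, then so is `C`, and its
curvature measure is, by the usual convention, the unit mass at this point. -/
def gaussCurvature (C : Set V) (H : AffineSubspace ℝ V) : Measure V :=
  if finrank ℝ H.direction = 0 then Measure.count.restrict C
  else Measure.map (fun u : Metric.sphere (0 : H.direction) 1 => supportPoint C ((u : H.direction) : V))
    (volume : Measure H.direction).toSphere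

/-- The center of mass of the section `K ∩ H` in `H`. -/
def sectionCentroid (K : Set V) (H : AffineSubspace ℝ V) : V :=
  centerOfMass (sectionVolume K H)

/-- The Steiner point of the section `K ∩ H` in `H`. -/
def sectionSteinerPoint (K : Set V) (H : AffineSubspace ℝ V) : V :=
  centerOfMass (gaussCurvature (K ∩ H) H)

end

/-!
A nonzero `v` and a real `t` determine the hyperplane `{x | ⟪v, x⟫ = t}`. Both the centroid and the
Steiner point select, for every hyperplane `H` that meets the interior of a convex body `K`, a point
`P H` of `H` in the interior of `K` that depends continuously on `H` (`IsSectionPoint`). The maps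
are constructed from these two properties alone.

* Near a given hyperplane, the sections are parametrized isometrically by subsets of one fixed space
  (`exists_hyperplane_parametrization`), so that both points are averages of functions on this
  space or on its unit sphere, and continuity follows from dominated convergence
  (`tendsto_sectionCentroid`, `tendsto_sectionSteinerPoint`). For the centroid, pointwise
  convergence fails at most on the relative boundary of the section, a null set. For the
  Steiner point, one needs that almost every unit vector is an outer normal at a single point: by
  Rademacher's theorem the support function is differentiable almost everywhere, and its
  derivative determines the support point (`IsSupportPoint.eq_of_differentiableAt`).
* An average of points of `K` lies in the interior of `K` unless some functional supporting `K` is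
  constant along the averaged function (`Convex.average_mem_interior_of_not_ae_eq`). This is not
  the case for either point.
* The linear hyperplanes correspond to the lines spanned by their normal vectors, so for them the
  map is simply `[v] ↦ P vᗮ` (`IsSectionPoint.exists_continuousMap_linear`).
* The affine hyperplanes that meet the interior of `K` correspond to the points `[v : s]` of the
  projective space other than `[0 : 1]`, with offset `hyperplaneOffset K v s`. As `[v : s]` tends to
  `[0 : 1]`, the hyperplanes become supporting, uniformly in their direction, so `P` tends to the
  boundary of `K`. Composing `P` with a map that collapses the boundary of `K` and identifies the
  quotient with the sphere (`exists_collapse_frontier`) gives a continuous map on the projective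
  space. The exceptional value is attained only at `[0 : 1]`, so all coincidences of two or more
  points are coincidences of section points (`IsSectionPoint.exists_continuousMap_affine`).
-/

section

open Set Filter Topology

/-! ### Isometric parametrizations of affine subspaces -/

section Parametrization

variable {V W : Type*} [NormedAddCommGroup V] [InnerProductSpace ℝ V] [NormedAddCommGroup W]
  [InnerProductSpace ℝ W]

theorem isometry_const_add_linearIsometry (b : V) (L : W →ₗᵢ[ℝ] V) :
    Isometry fun w => b + L w :=
  (IsometryEquiv.addLeft b).isometry.comp L.isometry

theorem range_const_add_linearIsometry {H : AffineSubspace ℝ V} {b : V} {L : W →ₗᵢ[ℝ] V}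
    (hb : b ∈ H) (hL : H.direction = L.toLinearMap.range) :
    range (fun w => b + L w) = H := by
  ext x
  constructor
  · rintro ⟨w, rfl⟩
    have : L w ∈ H.direction := by rw [hL]; exact ⟨w, rfl⟩
    simpa [add_comm] using AffineSubspace.vadd_mem_of_mem_direction this hb
  · intro hx
    have : x - b ∈ H.direction := AffineSubspace.vsub_mem_direction hx hb
    rw [hL] at this
    obtain ⟨w, hw⟩ := this
    exact ⟨w, by simp [show L w = x - b from hw]⟩

theorem mem_iff_exists_const_add_linearIsometry {H : AffineSubspace ℝ V} {b : V}
    {L : W →ₗᵢ[ℝ] V} (hb : b ∈ H) (hL : H.direction = L.toLinearMap.range) {x : V} :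
    x ∈ H ↔ ∃ w, b + L w = x := by
  rw [← SetLike.mem_coe, ← range_const_add_linearIsometry hb hL, mem_range]

variable [FiniteDimensional ℝ V] [MeasurableSpace V] [BorelSpace V] [FiniteDimensional ℝ W]
  [MeasurableSpace W] [BorelSpace W]

/-- The centroid as an average over a subset of a fixed space `W`. -/
theorem sectionCentroid_eq_setAverage {K : Set V} (hK : IsClosed K) {H : AffineSubspace ℝ V}
    {b : V} {L : W →ₗᵢ[ℝ] V} (hb : b ∈ H) (hL : H.direction = L.toLinearMap.range) :
    sectionCentroid K H = ⨍ w in {w | b + L w ∈ K}, (b + L w) := by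
  have hF := isometry_const_add_linearIsometry b L
  have hrank : finrank ℝ H.direction = finrank ℝ W := by
    rw [hL]; exact LinearMap.finrank_range_of_inj L.injective
  have hvol : sectionVolume K H =
      (volume.restrict {w | b + L w ∈ K}).map (fun w : W => b + L w) := by
    have h := hF.map_euclideanHausdorffMeasure (d := finrank ℝ W)
    rw [InnerProductSpace.euclideanHausdorffMeasure_eq_volume,
      range_const_add_linearIsometry hb hL] at h
    rw [sectionVolume, hrank, ← Measure.restrict_restrict hK.measurableSet, ← h,
      Measure.restrict_map hF.continuous.measurable hK.measurableSet]
    rfl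
  rw [sectionCentroid, centerOfMass, hvol, average_eq, average_eq,
    integral_map hF.continuous.measurable.aemeasurable (by fun_prop), measureReal_def,
    Measure.map_apply hF.continuous.measurable MeasurableSet.univ]
  simp [measureReal_def]

/-- The spherical measure is invariant under linear isometries. -/
theorem integral_toSphere_comp_linearIsometryEquiv {E : Type*} [NormedAddCommGroup E]
    [NormedSpace ℝ E] (e : W ≃ₗᵢ[ℝ] V) (φ : V → E) :
    ∫ u : Metric.sphere (0 : W) 1, φ (e u) ∂(volume : Measure W).toSphere =
      ∫ u : Metric.sphere (0 : V) 1, φ u ∂(volume : Measure V).toSphere := by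
  let g : Metric.sphere (0 : W) 1 ≃ₜ Metric.sphere (0 : V) 1 :=
    e.toHomeomorph.subtype (by simp)
  have hg : ∀ u, (g u : V) = e u := fun u => rfl
  have hmp : MeasurePreserving g (volume : Measure W).toSphere (volume : Measure V).toSphere := by
    refine ⟨g.continuous.measurable, ?_⟩
    ext s hs
    rw [Measure.map_apply g.continuous.measurable hs, Measure.toSphere_apply' _ hs,
      Measure.toSphere_apply' _ (g.continuous.measurable hs), e.toLinearEquiv.finrank_eq,
      ← e.measurePreserving.measure_preimage_equiv (f := e.toMeasurableEquiv)]
    congr 2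
    ext x
    simp only [Set.mem_smul, mem_preimage, mem_image]
    constructor
    · rintro ⟨r, hr, _, ⟨u, hu, rfl⟩, rfl⟩
      exact ⟨r, hr, _, ⟨g u, hu, rfl⟩, by simp [hg]⟩
    · rintro ⟨r, hr, _, ⟨u, hu, rfl⟩, hx⟩
      refine ⟨r, hr, _, ⟨g.symm u, by simpa using hu, rfl⟩, e.injective ?_⟩
      rw [map_smul, ← hg, g.apply_symm_apply]
      exact hx
  exact hmp.integral_comp g.measurableEmbedding (fun u => φ (u : V))

/-- The exceptional set of `p` is a cone, so its trace on the unit sphere is a null set as well. -/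
theorem ae_toSphere_of_ae_of_smul {p : W → Prop} (hp : MeasurableSet {w | p w})
    (hae : ∀ᵐ w, p w) (hsmul : ∀ (r : ℝ) (w : W), 0 < r → p (r • w) → p w) :
    ∀ᵐ u : Metric.sphere (0 : W) 1 ∂(volume : Measure W).toSphere, p u := by
  rw [ae_iff] at hae ⊢
  have hms : MeasurableSet {u : Metric.sphere (0 : W) 1 | ¬ p u} :=
    measurable_subtype_coe hp.compl
  rw [Measure.toSphere_apply' _ hms]
  refine mul_eq_zero_of_right _ (measure_mono_null ?_ hae)
  rintro _ ⟨r, hr, _, ⟨u, hu, rfl⟩, rfl⟩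
  exact fun h => hu (hsmul r _ hr.1 h)

end Parametrization

/-! ### Support points and the Steiner point -/

section SupportPoints

variable {V W : Type*} [NormedAddCommGroup V] [InnerProductSpace ℝ V] [NormedAddCommGroup W]
  [InnerProductSpace ℝ W]

/-- The support function of `C`. For compact nonempty `C`, the supremum is attained. -/
noncomputable def supportFunction (C : Set V) (v : V) : ℝ := sSup ((fun y => ⟪v, y⟫) '' C)

variable {C : Set V}

theorem IsCompact.exists_isSupportPoint (hC : IsCompact C) (hne : C.Nonempty) (v : V) :
    ∃ x, IsSupportPoint C v x := by
  obtain ⟨x, hx, hmax⟩ := hC.exists_isMaxOn hne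
    (f := fun y => ⟪v, y⟫) (by fun_prop)
  exact ⟨x, hx, hmax⟩

theorem IsSupportPoint.supportFunction_eq {v x : V} (h : IsSupportPoint C v x) :
    supportFunction C v = ⟪v, x⟫ :=
  IsGreatest.csSup_eq ⟨⟨x, h.1, rfl⟩, by rintro _ ⟨y, hy, rfl⟩; exact h.2 y hy⟩

theorem IsCompact.isSupportPoint_supportPoint (hC : IsCompact C) (hne : C.Nonempty) (v : V) :
    IsSupportPoint C v (supportPoint C v) :=
  Classical.epsilon_spec (hC.exists_isSupportPoint hne v)

theorem IsCompact.inner_le_supportFunction (hC : IsCompact C) (v : V) {y : V} (hy : y ∈ C) :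
    ⟪v, y⟫ ≤ supportFunction C v := by
  obtain ⟨x, hx⟩ := hC.exists_isSupportPoint ⟨y, hy⟩ v
  rw [hx.supportFunction_eq]
  exact hx.2 y hy

theorem IsSupportPoint.smul {v x : V} (h : IsSupportPoint C v x) {r : ℝ} (hr : 0 ≤ r) :
    IsSupportPoint C (r • v) x :=
  ⟨h.1, fun y hy => by
    simpa only [real_inner_smul_left] using mul_le_mul_of_nonneg_left (h.2 y hy) hr⟩

theorem IsCompact.supportFunction_smul (hC : IsCompact C) (hne : C.Nonempty) {r : ℝ}
    (hr : 0 ≤ r) (v : V) : supportFunction C (r • v) = r * supportFunction C v := by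
  obtain ⟨x, hx⟩ := hC.exists_isSupportPoint hne v
  rw [(hx.smul hr).supportFunction_eq, hx.supportFunction_eq, real_inner_smul_left]

theorem IsCompact.lipschitzWith_supportFunction (hC : IsCompact C) (hne : C.Nonempty) :
    ∃ R, LipschitzWith R (supportFunction C) := by
  obtain ⟨R, hR⟩ := hC.isBounded.exists_norm_le
  have hR0 : 0 ≤ R := (norm_nonneg _).trans (hR _ hne.some_mem)
  refine ⟨⟨R, hR0⟩, LipschitzWith.of_le_add_mul _ fun v v' => ?_⟩
  obtain ⟨x, hx⟩ := hC.exists_isSupportPoint hne v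
  rw [hx.supportFunction_eq]
  have h1 := hC.inner_le_supportFunction v' hx.1
  have h2 : ⟪v - v', x⟫ ≤ ‖v - v'‖ * R :=
    (real_inner_le_norm _ _).trans (mul_le_mul_of_nonneg_left (hR _ hx.1) (norm_nonneg _))
  rw [inner_sub_left] at h2
  rw [dist_eq_norm, mul_comm]
  exact (by linarith : ⟪v, x⟫ ≤ supportFunction C v' + ‖v - v'‖ * R)

variable [FiniteDimensional ℝ W]

/-- Where the support function is differentiable, its derivative determines the support point. -/
theorem IsSupportPoint.eq_of_differentiableAt (hC : IsCompact C) {b : V} {L : W →ₗᵢ[ℝ] V}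
    (hCb : C ⊆ range fun w => b + L w) {w : W} {x : V} (hx : IsSupportPoint C (L w) x)
    (hd : DifferentiableAt ℝ (fun w => supportFunction C (L w)) w) :
    x = b + L ((InnerProductSpace.toDual ℝ W).symm
      (fderiv ℝ (fun w => supportFunction C (L w)) w
        - (innerSL ℝ b).comp L.toContinuousLinearMap)) := by
  obtain ⟨a, rfl⟩ := hCb hx.1
  -- The support function lies above the linear form of `x` and touches it at `w`.
  have hfd : fderiv ℝ (fun w => supportFunction C (L w)) w =
      (innerSL ℝ (b + L a)).comp L.toContinuousLinearMap := by
    rw [← sub_eq_zero]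
    have hmin : IsLocalMin (fun w' => supportFunction C (L w') -
        (innerSL ℝ (b + L a)).comp L.toContinuousLinearMap w') w := by
      refine Eventually.of_forall fun w' => ?_
      have h1 := hC.inner_le_supportFunction (L w') hx.1
      have h2 := hx.supportFunction_eq
      rw [real_inner_comm] at h1 h2
      simp only [ContinuousLinearMap.comp_apply, innerSL_apply_apply,
        LinearIsometry.coe_toContinuousLinearMap, h2]
      linarith
    rw [← hmin.fderiv_eq_zero]
    exact ((hd.hasFDerivAt.sub (ContinuousLinearMap.hasFDerivAt _)).fderiv).symm
  congr 2
  rw [hfd, LinearIsometryEquiv.eq_symm_apply]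
  ext w'
  simp

variable [MeasurableSpace W] [BorelSpace W]

/-- Rademacher's theorem, on the unit sphere. -/
theorem IsCompact.ae_differentiableAt_supportFunction (hC : IsCompact C) (hne : C.Nonempty)
    (L : W →ₗᵢ[ℝ] V) :
    ∀ᵐ u : Metric.sphere (0 : W) 1 ∂(volume : Measure W).toSphere,
      DifferentiableAt ℝ (fun w => supportFunction C (L w)) u := by
  obtain ⟨R, hR⟩ := hC.lipschitzWith_supportFunction hne
  refine ae_toSphere_of_ae_of_smul (measurableSet_of_differentiableAt ℝ _)
    (hR.comp L.lipschitz).ae_differentiableAt fun r w hr h => ?_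
  have hcomp : (fun w => supportFunction C (L w)) =
      fun w => r⁻¹ * supportFunction C (L (r • w)) := by
    ext w
    rw [map_smul, hC.supportFunction_smul hne hr.le, inv_mul_cancel_left₀ hr.ne']
  rw [hcomp]
  exact (DifferentiableAt.comp (f := fun w : W => r • w)
    (g := fun w => supportFunction C (L w)) w h (by fun_prop)).const_mul _

/-- Almost every unit vector of `W` is, via `L`, an outer normal at exactly one point of `C`. -/
theorem IsCompact.ae_isSupportPoint_unique (hC : IsCompact C) (hne : C.Nonempty) {b : V}
    {L : W →ₗᵢ[ℝ] V} (hCb : C ⊆ range fun w => b + L w) :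
    ∀ᵐ u : Metric.sphere (0 : W) 1 ∂(volume : Measure W).toSphere,
      ∀ x, IsSupportPoint C (L u) x → x = supportPoint C (L u) := by
  filter_upwards [hC.ae_differentiableAt_supportFunction hne L] with u hu x hx
  rw [hx.eq_of_differentiableAt hC hCb hu,
    ← (hC.isSupportPoint_supportPoint hne _).eq_of_differentiableAt hC hCb hu]

variable [MeasurableSpace V] [BorelSpace V]

theorem IsCompact.aemeasurable_supportPoint (hC : IsCompact C) (hne : C.Nonempty) {b : V}
    {L : W →ₗᵢ[ℝ] V} (hCb : C ⊆ range fun w => b + L w) :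
    AEMeasurable (fun u : Metric.sphere (0 : W) 1 => supportPoint C (L u))
      (volume : Measure W).toSphere := by
  refine ⟨fun u => b + L ((InnerProductSpace.toDual ℝ W).symm
      (fderiv ℝ (fun w => supportFunction C (L w)) u
        - (innerSL ℝ b).comp L.toContinuousLinearMap)), ?_, ?_⟩
  · refine Measurable.const_add (L.continuous.measurable.comp
      ((InnerProductSpace.toDual ℝ W).symm.continuous.measurable.comp
        (Measurable.sub_const ?_ _))) _
    exact (measurable_fderiv ℝ _).comp measurable_subtype_coe
  · filter_upwards [hC.ae_differentiableAt_supportFunction hne L] with u hu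
    exact (hC.isSupportPoint_supportPoint hne _).eq_of_differentiableAt hC hCb hu

variable [FiniteDimensional ℝ V]

/-- The Steiner point as an average over the unit sphere of a fixed space `W`. The image measure that
defines the curvature measure is not the junk value `0`, because `supportPoint` agrees almost
everywhere with a measurable function. -/
theorem sectionSteinerPoint_eq_average {K : Set V} (hK : IsCompact K) {H : AffineSubspace ℝ V}
    (hKH : (K ∩ H).Nonempty) {b : V} {L : W →ₗᵢ[ℝ] V} (hb : b ∈ H)
    (hL : H.direction = L.toLinearMap.range) (hW : finrank ℝ W ≠ 0) :
    sectionSteinerPoint K H = ⨍ u : Metric.sphere (0 : W) 1, supportPoint (K ∩ H) (L u)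
      ∂(volume : Measure W).toSphere := by
  let e₀ : W →ₗᵢ[ℝ] H.direction :=
    { toLinearMap := L.toLinearMap.codRestrict H.direction fun w => by rw [hL]; exact ⟨w, rfl⟩
      norm_map' := fun w => L.norm_map w }
  let e : W ≃ₗᵢ[ℝ] H.direction := LinearIsometryEquiv.ofSurjective e₀ fun ⟨x, hx⟩ => by
    rw [hL] at hx
    obtain ⟨w, hw⟩ := hx
    exact ⟨w, Subtype.ext hw⟩
  have hrank : finrank ℝ H.direction ≠ 0 := by rwa [← e.toLinearEquiv.finrank_eq]
  have hC : IsCompact (K ∩ H) := hK.inter_right H.closed_of_finiteDimensional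
  have hmeas : AEMeasurable (fun u : Metric.sphere (0 : H.direction) 1 =>
      supportPoint (K ∩ H) ((u : H.direction) : V)) (volume : Measure H.direction).toSphere :=
    hC.aemeasurable_supportPoint hKH (b := b) (L := H.direction.subtypeₗᵢ) (by
    rw [range_const_add_linearIsometry hb (by simp)]; exact inter_subset_right)
  rw [sectionSteinerPoint, centerOfMass, gaussCurvature, if_neg hrank, average_eq, average_eq,
    measureReal_def, Measure.map_apply_of_aemeasurable hmeas MeasurableSet.univ,
    integral_map hmeas (by fun_prop), preimage_univ, ← measureReal_def,
    ← integral_toSphere_comp_linearIsometryEquiv e (fun u => supportPoint (K ∩ H) (u : V))]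
  congr 2
  have := integral_toSphere_comp_linearIsometryEquiv e (fun _ => (1 : ℝ))
  simpa using this.symm

end SupportPoints

/-! ### Averages over convex bodies -/

section InteriorAverage

/-- If the average of a function with values in a convex body `K` is a boundary point, then a
functional supporting `K` there is constant along the function. -/
theorem Convex.average_mem_interior_of_not_ae_eq {α E : Type*} {m : MeasurableSpace α}
    [NormedAddCommGroup E] [NormedSpace ℝ E] [CompleteSpace E] {μ : Measure α}
    [IsFiniteMeasure μ] [NeZero μ] {K : Set E} (hconv : Convex ℝ K)
    (hne : (interior K).Nonempty) {f : α → E} (hf : Integrable f μ) (hfK : ∀ᵐ a ∂μ, f a ∈ K)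
    (hfun : ∀ ℓ : E →L[ℝ] ℝ, (∀ y ∈ interior K, ℓ y < ℓ (⨍ a, f a ∂μ)) →
      ¬ ∀ᵐ a ∂μ, ℓ (f a) = ℓ (⨍ a, f a ∂μ)) :
    ⨍ a, f a ∂μ ∈ interior K := by
  by_contra hnot
  obtain ⟨ℓ, hℓ⟩ := geometric_hahn_banach_open_point hconv.interior isOpen_interior hnot
  refine hfun ℓ hℓ ?_
  have hle : ∀ y ∈ K, ℓ y ≤ ℓ (⨍ a, f a ∂μ) := by
    intro y hy
    have hcl : y ∈ closure (interior K) := by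
      rw [hconv.closure_interior_eq_closure_of_nonempty_interior hne]
      exact subset_closure hy
    exact closure_minimal (fun z hz => (hℓ z hz).le)
      (isClosed_le ℓ.continuous continuous_const) hcl
  have hint : Integrable (fun a => ℓ (⨍ a, f a ∂μ) - ℓ (f a)) μ :=
    (integrable_const _).sub (ℓ.integrable_comp hf)
  have hnn : 0 ≤ᵐ[μ] fun a => ℓ (⨍ a, f a ∂μ) - ℓ (f a) := by
    filter_upwards [hfK] with a ha
    exact sub_nonneg.2 (hle _ ha)
  have hzero : ∫ a, (ℓ (⨍ a, f a ∂μ) - ℓ (f a)) ∂μ = 0 := by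
    have hμ : μ.real univ ≠ 0 := by
      simp [measureReal_def, ENNReal.toReal_eq_zero_iff, NeZero.ne μ]
    rw [integral_sub (integrable_const _) (ℓ.integrable_comp hf), ℓ.integral_comp_comm hf,
      average_eq]
    simp [hμ]
  filter_upwards [(integral_eq_zero_iff_of_nonneg_ae hnn hint).1 hzero] with a ha
  exact (sub_eq_zero.1 ha).symm

end InteriorAverage

/-! ### Section points lie in the interior of the body -/

section Sections

variable {V W : Type*} [NormedAddCommGroup V] [InnerProductSpace ℝ V] [NormedAddCommGroup W]
  [InnerProductSpace ℝ W] {K : Set V}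

theorem Convex.preimage_const_add_linearIsometry (hconv : Convex ℝ K) (b : V) (L : W →ₗᵢ[ℝ] V) :
    Convex ℝ {w | b + L w ∈ K} :=
  (hconv.translate_preimage_right b).linear_preimage L.toLinearMap

/-- If a section meets the interior of `K`, then its part in the interior of `K` is dense in it. -/
theorem Convex.preimage_subset_closure_preimage_interior (hconv : Convex ℝ K) {b : V}
    {L : W →ₗᵢ[ℝ] V} (hne : ∃ w, b + L w ∈ interior K) :
    {w | b + L w ∈ K} ⊆ closure {w | b + L w ∈ interior K} := by
  obtain ⟨y, hy⟩ := hne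
  intro w hw
  refine closure_mono ?_ (segment_subset_closure_openSegment (right_mem_segment ℝ y w))
  rintro _ ⟨s, t, hs, ht, hst, rfl⟩
  refine hconv.openSegment_interior_self_subset_interior hy hw ⟨s, t, hs, ht, hst, ?_⟩
  have : b = s • b + t • b := by rw [← add_smul, hst, one_smul]
  conv_rhs => rw [this]
  simp only [map_add, map_smul, smul_add]
  abel

theorem Convex.interior_preimage_subset (hconv : Convex ℝ K) {b : V}
    {L : W →ₗᵢ[ℝ] V} (hne : ∃ w, b + L w ∈ interior K) :
    interior {w | b + L w ∈ K} ⊆ {w | b + L w ∈ interior K} := by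
  have hopen : IsOpen {w | b + L w ∈ interior K} :=
    isOpen_interior.preimage (by fun_prop : Continuous fun w => b + L w)
  have h := interior_mono (hconv.preimage_subset_closure_preimage_interior hne)
  rwa [(hconv.interior.preimage_const_add_linearIsometry b L
    ).interior_closure_eq_interior_of_nonempty_interior (by rwa [hopen.interior_eq]),
    hopen.interior_eq] at h

theorem IsCompact.preimage_const_add_linearIsometry [FiniteDimensional ℝ W] (hK : IsCompact K)
    (b : V) (L : W →ₗᵢ[ℝ] V) : IsCompact {w | b + L w ∈ K} :=
  ((isometry_const_add_linearIsometry b L).isClosedEmbedding).isCompact_preimage hK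

/-- The support points of a section correspond to those of its preimage under the parametrization. -/
theorem isSupportPoint_inter_iff {H : AffineSubspace ℝ V} {b : V} {L : W →ₗᵢ[ℝ] V} (hb : b ∈ H)
    (hL : H.direction = L.toLinearMap.range) {u w : W} :
    IsSupportPoint (K ∩ H) (L u) (b + L w) ↔ IsSupportPoint {w | b + L w ∈ K} u w := by
  have hmem : ∀ w, b + L w ∈ H := fun w =>
    (mem_iff_exists_const_add_linearIsometry hb hL).2 ⟨w, rfl⟩
  constructor
  · rintro ⟨h1, h2⟩
    refine ⟨h1.1, fun y hy => ?_⟩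
    simpa [inner_add_right] using h2 (b + L y) ⟨hy, hmem y⟩
  · rintro ⟨h1, h2⟩
    refine ⟨⟨h1, hmem w⟩, ?_⟩
    rintro y ⟨hyK, hyH⟩
    obtain ⟨y, rfl⟩ := (mem_iff_exists_const_add_linearIsometry hb hL).1 hyH
    simpa [inner_add_right] using h2 y hyK

theorem exists_mem_interior_of_inter_nonempty {H : AffineSubspace ℝ V} {b : V} {L : W →ₗᵢ[ℝ] V}
    (hb : b ∈ H) (hL : H.direction = L.toLinearMap.range)
    (hne : ((H : Set V) ∩ interior K).Nonempty) : ∃ w, b + L w ∈ interior K := by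
  obtain ⟨y, hyH, hyK⟩ := hne
  obtain ⟨y, rfl⟩ := (mem_iff_exists_const_add_linearIsometry hb hL).1 hyH
  exact ⟨y, hyK⟩

variable [FiniteDimensional ℝ V] [MeasurableSpace V] [BorelSpace V] [FiniteDimensional ℝ W]
  {H : AffineSubspace ℝ V} {b : V} {L : W →ₗᵢ[ℝ] V}

/-- If the hyperplane is a point, then the curvature measure is the unit mass there. -/
theorem sectionSteinerPoint_eq_of_finrank_eq_zero (hb : b ∈ H)
    (hL : H.direction = L.toLinearMap.range) (hW : finrank ℝ W = 0) (hbK : b ∈ K) :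
    sectionSteinerPoint K H = b := by
  have hsub : Subsingleton W := finrank_zero_iff.1 hW
  have hrank : finrank ℝ H.direction = 0 := by
    rw [hL, ← hW]; exact LinearMap.finrank_range_of_inj L.injective
  have hH : (H : Set V) = {b} := by
    rw [← range_const_add_linearIsometry hb hL]
    ext x
    simp only [mem_range, mem_singleton_iff]
    constructor
    · rintro ⟨w, rfl⟩
      simp [Subsingleton.elim w 0]
    · rintro rfl
      exact ⟨0, by simp⟩
  have hKH : K ∩ H = {b} := by rw [hH]; simpa using hbK
  rw [sectionSteinerPoint, hKH, centerOfMass, gaussCurvature, if_pos hrank,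
    Measure.restrict_singleton, Measure.count_singleton, one_smul, average_eq]
  simp

variable [MeasurableSpace W] [BorelSpace W]

/-- The part of the section in the interior of `K` has positive volume, and on it a functional
supporting `K` at a boundary point is not maximal. -/
theorem sectionCentroid_mem (hconv : Convex ℝ K) (hK : IsCompact K) (hb : b ∈ H)
    (hL : H.direction = L.toLinearMap.range) (hne : ((H : Set V) ∩ interior K).Nonempty) :
    sectionCentroid K H ∈ (H : Set V) ∩ interior K := by
  obtain ⟨y, hy⟩ := exists_mem_interior_of_inter_nonempty hb hL hne
  have hcont : Continuous fun w => b + L w := by fun_prop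
  have hA := hK.preimage_const_add_linearIsometry b L
  have hopen : IsOpen {w | b + L w ∈ interior K} := isOpen_interior.preimage hcont
  have hsub : {w | b + L w ∈ interior K} ⊆ {w | b + L w ∈ K} :=
    preimage_mono interior_subset
  have hpos : (volume : Measure W) {w | b + L w ∈ interior K} ≠ 0 :=
    (hopen.measure_pos _ ⟨y, hy⟩).ne'
  have hfin : IsFiniteMeasure ((volume : Measure W).restrict {w | b + L w ∈ K}) :=
    ⟨by simpa using hA.measure_lt_top⟩
  have hnz : NeZero ((volume : Measure W).restrict {w | b + L w ∈ K}) :=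
    ⟨fun h => hpos (measure_mono_null hsub (Measure.restrict_eq_zero.1 h))⟩
  have hint : IntegrableOn (fun w => b + L w) {w | b + L w ∈ K} :=
    hcont.continuousOn.integrableOn_compact hA
  have hmemK : ∀ᵐ w ∂(volume : Measure W).restrict {w | b + L w ∈ K}, b + L w ∈ K :=
    ae_restrict_mem hA.measurableSet
  rw [sectionCentroid_eq_setAverage hK.isClosed hb hL]
  refine ⟨H.convex.average_mem H.closed_of_finiteDimensional (Eventually.of_forall fun w => ?_)
    hint, hconv.average_mem_interior_of_not_ae_eq ⟨_, hy⟩ hint hmemK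
    fun ℓ hℓ hae => hpos ?_⟩
  · exact (mem_iff_exists_const_add_linearIsometry hb hL).2 ⟨w, rfl⟩
  · rw [ae_restrict_iff' hA.measurableSet, ae_iff] at hae
    refine measure_mono_null (fun w hw => ?_) hae
    simp only [mem_ofPred_eq, Classical.not_imp]
    exact ⟨hsub hw, (hℓ _ hw).ne⟩

/-- A functional supporting `K` at the Steiner point would be constant on almost all support points of
the section. -/
theorem sectionSteinerPoint_mem (hconv : Convex ℝ K) (hK : IsCompact K) (hb : b ∈ H)
    (hL : H.direction = L.toLinearMap.range) (hne : ((H : Set V) ∩ interior K).Nonempty) :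
    sectionSteinerPoint K H ∈ (H : Set V) ∩ interior K := by
  obtain ⟨y, hy⟩ := exists_mem_interior_of_inter_nonempty hb hL hne
  rcases eq_or_ne (finrank ℝ W) 0 with hW | hW
  · have hsub : Subsingleton W := finrank_zero_iff.1 hW
    rw [Subsingleton.elim y 0, map_zero, add_zero] at hy
    rw [sectionSteinerPoint_eq_of_finrank_eq_zero hb hL hW (interior_subset hy)]
    exact ⟨hb, hy⟩
  have hyH : b + L y ∈ H := (mem_iff_exists_const_add_linearIsometry hb hL).2 ⟨y, rfl⟩
  have hnt : Nontrivial W := finrank_pos_iff.1 (Nat.pos_of_ne_zero hW)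
  have hKH : (K ∩ H).Nonempty := ⟨_, interior_subset hy, hyH⟩
  have hC : IsCompact (K ∩ H) := hK.inter_right H.closed_of_finiteDimensional
  have hsp := hC.isSupportPoint_supportPoint hKH
  have hnz : NeZero (volume : Measure W).toSphere := ⟨Measure.toSphere_ne_zero _⟩
  obtain ⟨R, hR⟩ := hK.isBounded.exists_norm_le
  have hint : Integrable (fun u : Metric.sphere (0 : W) 1 => supportPoint (K ∩ H) (L u))
      (volume : Measure W).toSphere :=
    Integrable.of_bound (hC.aemeasurable_supportPoint hKH (b := b) (by
      rw [range_const_add_linearIsometry hb hL]; exact inter_subset_right)).aestronglyMeasurable R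
      (Eventually.of_forall fun u => hR _ (hsp _).1.1)
  have hPH : sectionSteinerPoint K H ∈ H := by
    rw [sectionSteinerPoint_eq_average hK hKH hb hL hW]
    exact H.convex.average_mem H.closed_of_finiteDimensional
      (Eventually.of_forall fun u => (hsp _).1.2) hint
  refine ⟨hPH, ?_⟩
  obtain ⟨p, hp⟩ := (mem_iff_exists_const_add_linearIsometry hb hL).1 hPH
  rw [sectionSteinerPoint_eq_average hK hKH hb hL hW] at hp ⊢
  refine hconv.average_mem_interior_of_not_ae_eq ⟨_, hy⟩ hint
    (Eventually.of_forall fun u => (hsp _).1.1) fun ℓ hℓ hae => ?_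
  rw [← hp] at hae hℓ
  -- `a` represents the restriction of `ℓ` to the direction of `H`. It is nonzero, and near the
  -- unit vector opposite to `a` the support points have smaller values of `ℓ` than `b + L y`.
  obtain ⟨a, ha⟩ : ∃ a : W, ∀ w, ℓ (L w) = ⟪a, w⟫ :=
    ⟨(InnerProductSpace.toDual ℝ W).symm (ℓ.comp L.toContinuousLinearMap), fun w => by simp⟩
  have hyp : ⟪a, y⟫ < ⟪a, p⟫ := by
    simpa [ha] using hℓ _ hy
  have ha0 : a ≠ 0 := by rintro rfl; simp at hyp
  have hapos : 0 < ‖a‖ := norm_pos_iff.2 ha0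
  obtain ⟨M, hM⟩ := (hK.preimage_const_add_linearIsometry b L).isBounded.exists_norm_le
  let v : Metric.sphere (0 : W) 1 := ⟨-(‖a‖⁻¹ • a), by simp [norm_smul, hapos.ne']⟩
  have hv : ∀ w, ⟪(v : W), w⟫ = -(‖a‖⁻¹ * ⟪a, w⟫) := fun w => by
    simp [v, inner_neg_left, real_inner_smul_left]
  have hall : ∀ᵐ u : Metric.sphere (0 : W) 1 ∂(volume : Measure W).toSphere,
      ‖a‖⁻¹ * (⟪a, p⟫ - ⟪a, y⟫) ≤ ‖(v : W) - u‖ * (2 * M) := by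
    filter_upwards [hae] with u hu
    have hx := hsp (L u)
    obtain ⟨w, hw⟩ : ∃ w, b + L w = supportPoint (K ∩ H) (L u) :=
      (mem_iff_exists_const_add_linearIsometry hb hL).1 hx.1.2
    rw [← hw] at hx hu
    have haw : ⟪a, w⟫ = ⟪a, p⟫ := by simpa [ha] using hu
    rw [isSupportPoint_inter_iff hb hL] at hx
    have hyK : b + L y ∈ K := interior_subset hy
    have h1 := hx.2 y hyK
    have h2 : ⟪(v : W) - u, y - w⟫ ≤ ‖(v : W) - u‖ * (2 * M) := by
      refine (real_inner_le_norm _ _).trans (mul_le_mul_of_nonneg_left ?_ (norm_nonneg _))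
      have := norm_sub_le y w
      have := hM y hyK
      have := hM w hx.1
      linarith
    rw [inner_sub_left, inner_sub_right, inner_sub_right, hv, hv, haw] at h2
    linarith
  have hcl : IsClosed {u : Metric.sphere (0 : W) 1 |
      ‖a‖⁻¹ * (⟪a, p⟫ - ⟪a, y⟫) ≤ ‖(v : W) - u‖ * (2 * M)} :=
    isClosed_le (by fun_prop) (by fun_prop)
  have hvmem : v ∈ {u : Metric.sphere (0 : W) 1 |
      ‖a‖⁻¹ * (⟪a, p⟫ - ⟪a, y⟫) ≤ ‖(v : W) - u‖ * (2 * M)} := by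
    rw [← hcl.closure_eq, (Measure.dense_of_ae hall).closure_eq]
    trivial
  rw [mem_ofPred_eq, sub_self, norm_zero, zero_mul] at hvmem
  exact absurd hvmem (not_le.2 (mul_pos (inv_pos.2 hapos) (sub_pos.2 hyp)))

end Sections

/-! ### Continuous dependence on the affine subspace -/

section Continuity

variable {V W ι : Type*} [NormedAddCommGroup V] [InnerProductSpace ℝ V]
  [NormedAddCommGroup W] [InnerProductSpace ℝ W] {K : Set V} {l : Filter ι}
  {b : ι → V} {L : ι → W →ₗᵢ[ℝ] V} {b₀ : V} {L₀ : W →ₗᵢ[ℝ] V}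

/-- Linear isometries that converge pointwise do so along convergent arguments, being uniformly
Lipschitz. -/
theorem tendsto_linearIsometry_apply (hL : ∀ w, Tendsto (fun i => L i w) l (𝓝 (L₀ w)))
    {w : ι → W} {w₀ : W} (hw : Tendsto w l (𝓝 w₀)) :
    Tendsto (fun i => L i (w i)) l (𝓝 (L₀ w₀)) := by
  have h : Tendsto (fun i => L i (w i - w₀)) l (𝓝 0) := by
    rw [tendsto_zero_iff_norm_tendsto_zero]
    simpa only [LinearIsometry.norm_map] using tendsto_iff_norm_sub_tendsto_zero.1 hw
  simpa using h.add (hL w₀)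

theorem eventually_preimage_subset_closedBall (hK : IsCompact K) (hb : Tendsto b l (𝓝 b₀)) :
    ∃ ρ, ∀ᶠ i in l, {w | b i + L i w ∈ K} ⊆ Metric.closedBall 0 ρ := by
  obtain ⟨R, hR⟩ := hK.isBounded.exists_norm_le
  refine ⟨R + (‖b₀‖ + 1), ?_⟩
  filter_upwards [hb.norm.eventually (gt_mem_nhds (lt_add_one _))] with i hi w hw
  rw [mem_closedBall_zero_iff, ← (L i).norm_map, ← add_sub_cancel_left (b i) (L i w)]
  exact (norm_sub_le _ _).trans (add_le_add (hR _ hw) hi.le)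

variable [FiniteDimensional ℝ W] {H : ι → AffineSubspace ℝ V} {H₀ : AffineSubspace ℝ V}

/-- Where the support point of the limit section is unique, support points converge: by compactness
they have cluster points, and every cluster point is a support point, because each point of the
section in the interior of `K` is a limit of points of the nearby sections. -/
theorem tendsto_supportPoint [FiniteDimensional ℝ V] (hconv : Convex ℝ K) (hK : IsCompact K)
    (hb : Tendsto b l (𝓝 b₀)) (hL : ∀ w, Tendsto (fun i => L i w) l (𝓝 (L₀ w)))
    (hH : ∀ᶠ i in l, b i ∈ H i ∧ (H i).direction = (L i).toLinearMap.range)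
    (hb₀ : b₀ ∈ H₀) (hL₀ : H₀.direction = L₀.toLinearMap.range)
    (hne : ((H₀ : Set V) ∩ interior K).Nonempty) {u : W}
    (hu : ∀ x, IsSupportPoint (K ∩ H₀) (L₀ u) x → x = supportPoint (K ∩ H₀) (L₀ u)) :
    Tendsto (fun i => supportPoint (K ∩ H i) (L i u)) l
      (𝓝 (supportPoint (K ∩ H₀) (L₀ u))) := by
  obtain ⟨y, hy⟩ := exists_mem_interior_of_inter_nonempty hb₀ hL₀ hne
  have hF : ∀ w, Tendsto (fun i => b i + L i w) l (𝓝 (b₀ + L₀ w)) := fun w => hb.add (hL w)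
  have hex : ∀ᶠ i in l, ∃ w, b i + L i w = supportPoint (K ∩ H i) (L i u) ∧
      IsSupportPoint {w | b i + L i w ∈ K} u w := by
    filter_upwards [hH, (hF y).eventually (isOpen_interior.mem_nhds hy)] with i hi hyi
    have hyH : b i + L i y ∈ H i :=
      (mem_iff_exists_const_add_linearIsometry hi.1 hi.2).2 ⟨y, rfl⟩
    have hx := (hK.inter_right (H i).closed_of_finiteDimensional).isSupportPoint_supportPoint
      ⟨_, interior_subset hyi, hyH⟩ (L i u)
    obtain ⟨w, hw⟩ : ∃ w, b i + L i w = supportPoint (K ∩ H i) (L i u) :=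
      (mem_iff_exists_const_add_linearIsometry hi.1 hi.2).1 hx.1.2
    rw [← hw, isSupportPoint_inter_iff hi.1 hi.2] at hx
    exact ⟨w, hw, hx⟩
  rcases l.eq_or_neBot with rfl | hl
  · exact tendsto_bot
  obtain ⟨w, hw⟩ := hex.choice
  obtain ⟨ρ, hρ⟩ := eventually_preimage_subset_closedBall (L := L) hK hb
  rw [tendsto_iff_ultrafilter]
  intro G hG
  have hball : ∀ᶠ i in G, w i ∈ Metric.closedBall (0 : W) ρ :=
    hG ((hw.and hρ).mono fun i hi => hi.2 hi.1.2.1)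
  obtain ⟨w₀, -, hw₀⟩ := (isCompact_closedBall (0 : W) ρ).ultrafilter_le_nhds (G.map w)
    (le_principal_iff.2 hball)
  have hw₀ : Tendsto w G (𝓝 w₀) := hw₀
  have hlim : Tendsto (fun i => b i + L i (w i)) G (𝓝 (b₀ + L₀ w₀)) :=
    (hb.mono_left hG).add (tendsto_linearIsometry_apply (fun w => (hL w).mono_left hG) hw₀)
  have hsupp : IsSupportPoint (K ∩ H₀) (L₀ u) (b₀ + L₀ w₀) := by
    rw [isSupportPoint_inter_iff hb₀ hL₀]
    refine ⟨hK.isClosed.mem_of_tendsto hlim (hG (hw.mono fun i hi => hi.2.1)), fun z hz => ?_⟩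
    refine closure_minimal (t := {z | ⟪u, z⟫ ≤ ⟪u, w₀⟫}) (fun z hz => ?_)
      (isClosed_le (by fun_prop) continuous_const)
      (hconv.preimage_subset_closure_preimage_interior ⟨y, hy⟩ hz)
    refine ge_of_tendsto (Tendsto.inner (𝕜 := ℝ) (tendsto_const_nhds (x := u)) hw₀) (hG ?_)
    filter_upwards [hw, (hF z).eventually (isOpen_interior.mem_nhds hz)] with i hi hzi
    have hzK : b i + L i z ∈ K := interior_subset hzi
    exact hi.2.2 z hzK
  rw [← hu _ hsupp]
  exact hlim.congr' (hG (hw.mono fun i hi => hi.1))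

variable [MeasurableSpace W] [BorelSpace W]

/-- Integrals over the sections of `K` converge, by dominated convergence. -/
theorem tendsto_setIntegral_preimage {E : Type*} [NormedAddCommGroup E] [NormedSpace ℝ E]
    [SecondCountableTopology E] [l.IsCountablyGenerated] (hconv : Convex ℝ K) (hK : IsCompact K)
    (hb : Tendsto b l (𝓝 b₀)) (hL : ∀ w, Tendsto (fun i => L i w) l (𝓝 (L₀ w)))
    (hne : ∃ w, b₀ + L₀ w ∈ interior K) {g : ι → W → E} {g₀ : W → E}
    (hg : ∀ w, Tendsto (fun i => g i w) l (𝓝 (g₀ w))) (hgc : ∀ i, Continuous (g i)) {M : ℝ}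
    (hM0 : 0 ≤ M) (hM : ∀ i w, b i + L i w ∈ K → ‖g i w‖ ≤ M) :
    Tendsto (fun i => ∫ w in {w | b i + L i w ∈ K}, g i w) l
      (𝓝 (∫ w in {w | b₀ + L₀ w ∈ K}, g₀ w)) := by
  have hmeas : ∀ (b : V) (L : W →ₗᵢ[ℝ] V), MeasurableSet {w | b + L w ∈ K} := fun b L =>
    (hK.preimage_const_add_linearIsometry b L).measurableSet
  have hF : ∀ w, Tendsto (fun i => b i + L i w) l (𝓝 (b₀ + L₀ w)) := fun w => hb.add (hL w)
  simp only [← integral_indicator (hmeas _ _)]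
  obtain ⟨ρ, hρ⟩ := eventually_preimage_subset_closedBall (L := L) hK hb
  refine tendsto_integral_filter_of_dominated_convergence
    ((Metric.closedBall (0 : W) ρ).indicator fun _ => M) (Eventually.of_forall fun i =>
      ((hgc i).stronglyMeasurable.indicator (hmeas _ _)).aestronglyMeasurable) ?_ ?_ ?_
  · filter_upwards [hρ] with i hi
    refine Eventually.of_forall fun w => ?_
    by_cases hw : w ∈ {w | b i + L i w ∈ K}
    · rw [indicator_of_mem hw, indicator_of_mem (hi hw)]
      exact hM i w hw
    · rw [indicator_of_notMem hw, norm_zero]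
      exact indicator_nonneg (fun _ _ => hM0) _
  · rw [integrable_indicator_iff measurableSet_closedBall]
    exact integrableOn_const measure_closedBall_lt_top.ne
  · -- The sections vary continuously away from the frontier of the limit section, a null set.
    have hnull := (hconv.preimage_const_add_linearIsometry b₀ L₀).addHaar_frontier
      (volume : Measure W)
    filter_upwards [compl_mem_ae_iff.2 hnull] with w hw
    by_cases hwK : b₀ + L₀ w ∈ K
    · have hint : w ∈ interior {w | b₀ + L₀ w ∈ K} := by
        by_contra h
        exact hw ⟨subset_closure hwK, h⟩
      have hev := (hF w).eventually (isOpen_interior.mem_nhds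
        (hconv.interior_preimage_subset hne hint))
      rw [indicator_of_mem (show w ∈ {w | b₀ + L₀ w ∈ K} from hwK)]
      refine (hg w).congr' ?_
      filter_upwards [hev] with i hi
      have hiK : b i + L i w ∈ K := interior_subset hi
      rw [indicator_of_mem (show w ∈ {w | b i + L i w ∈ K} from hiK)]
    · have hev := (hF w).eventually (hK.isClosed.isOpen_compl.mem_nhds hwK)
      rw [indicator_of_notMem (show w ∉ {w | b₀ + L₀ w ∈ K} from hwK)]
      refine tendsto_const_nhds.congr' ?_
      filter_upwards [hev] with i hi
      rw [indicator_of_notMem (show w ∉ {w | b i + L i w ∈ K} from hi)]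

variable [FiniteDimensional ℝ V] [MeasurableSpace V] [BorelSpace V]

theorem tendsto_sectionCentroid [l.IsCountablyGenerated] (hconv : Convex ℝ K) (hK : IsCompact K)
    (hb : Tendsto b l (𝓝 b₀)) (hL : ∀ w, Tendsto (fun i => L i w) l (𝓝 (L₀ w)))
    (hH : ∀ᶠ i in l, b i ∈ H i ∧ (H i).direction = (L i).toLinearMap.range)
    (hb₀ : b₀ ∈ H₀) (hL₀ : H₀.direction = L₀.toLinearMap.range)
    (hne : ((H₀ : Set V) ∩ interior K).Nonempty) :
    Tendsto (fun i => sectionCentroid K (H i)) l (𝓝 (sectionCentroid K H₀)) := by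
  have hne' := exists_mem_interior_of_inter_nonempty hb₀ hL₀ hne
  rw [sectionCentroid_eq_setAverage hK.isClosed hb₀ hL₀]
  have hev : (fun i => ⨍ w in {w | b i + L i w ∈ K}, (b i + L i w)) =ᶠ[l]
      fun i => sectionCentroid K (H i) := by
    filter_upwards [hH] with i hi
    exact (sectionCentroid_eq_setAverage hK.isClosed hi.1 hi.2).symm
  refine Tendsto.congr' hev ?_
  obtain ⟨R, hR⟩ := hK.isBounded.exists_norm_le
  have hR0 : 0 ≤ R := (norm_nonneg _).trans (hR _ (interior_subset hne.some_mem.2))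
  simp only [setAverage_eq]
  refine Tendsto.smul (Tendsto.inv₀ ?_ ?_)
    (tendsto_setIntegral_preimage hconv hK hb hL hne' (fun w => hb.add (hL w))
      (fun i => by fun_prop) hR0 fun i w hw => hR _ hw)
  · simpa using tendsto_setIntegral_preimage hconv hK hb hL hne' (g := fun _ _ => (1 : ℝ))
      (g₀ := fun _ => 1) (fun _ => tendsto_const_nhds) (fun _ => continuous_const) zero_le_one
      (fun _ _ _ => by simp)
  · obtain ⟨y, hy⟩ := hne'
    refine (ENNReal.toReal_pos ?_
      (hK.preimage_const_add_linearIsometry b₀ L₀).measure_lt_top.ne).ne'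
    have hopen : IsOpen {w | b₀ + L₀ w ∈ interior K} :=
      isOpen_interior.preimage (by fun_prop : Continuous fun w => b₀ + L₀ w)
    exact ((hopen.measure_pos volume ⟨y, hy⟩).trans_le
      (measure_mono (preimage_mono interior_subset))).ne'

theorem tendsto_sectionSteinerPoint [l.IsCountablyGenerated] (hconv : Convex ℝ K)
    (hK : IsCompact K)
    (hb : Tendsto b l (𝓝 b₀)) (hL : ∀ w, Tendsto (fun i => L i w) l (𝓝 (L₀ w)))
    (hH : ∀ᶠ i in l, b i ∈ H i ∧ (H i).direction = (L i).toLinearMap.range)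
    (hb₀ : b₀ ∈ H₀) (hL₀ : H₀.direction = L₀.toLinearMap.range)
    (hne : ((H₀ : Set V) ∩ interior K).Nonempty) :
    Tendsto (fun i => sectionSteinerPoint K (H i)) l (𝓝 (sectionSteinerPoint K H₀)) := by
  obtain ⟨y, hy⟩ := exists_mem_interior_of_inter_nonempty hb₀ hL₀ hne
  have hyev : ∀ᶠ i in l, b i + L i y ∈ interior K :=
    (hb.add (hL y)).eventually (isOpen_interior.mem_nhds hy)
  rcases eq_or_ne (finrank ℝ W) 0 with hW | hW
  · have hsub : Subsingleton W := finrank_zero_iff.1 hW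
    simp only [Subsingleton.elim y 0, map_zero, add_zero] at hy hyev
    rw [sectionSteinerPoint_eq_of_finrank_eq_zero hb₀ hL₀ hW (interior_subset hy)]
    refine hb.congr' ?_
    filter_upwards [hH, hyev] with i hi hyi
    rw [sectionSteinerPoint_eq_of_finrank_eq_zero hi.1 hi.2 hW (interior_subset hyi)]
  have hKH : ∀ {H : AffineSubspace ℝ V} {b : V} {L : W →ₗᵢ[ℝ] V}, b ∈ H →
      H.direction = L.toLinearMap.range → b + L y ∈ interior K → (K ∩ H).Nonempty := by
    intro H b L hb hL hy
    exact ⟨_, interior_subset hy, (mem_iff_exists_const_add_linearIsometry hb hL).2 ⟨y, rfl⟩⟩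
  obtain ⟨R, hR⟩ := hK.isBounded.exists_norm_le
  rw [sectionSteinerPoint_eq_average hK (hKH hb₀ hL₀ hy) hb₀ hL₀ hW]
  have hev : (fun i => ⨍ u : Metric.sphere (0 : W) 1, supportPoint (K ∩ H i) (L i u)
      ∂(volume : Measure W).toSphere) =ᶠ[l] fun i => sectionSteinerPoint K (H i) := by
    filter_upwards [hH, hyev] with i hi hyi
    rw [sectionSteinerPoint_eq_average hK (hKH hi.1 hi.2 hyi) hi.1 hi.2 hW]
  refine Tendsto.congr' hev ?_
  simp only [average_eq]
  refine Tendsto.const_smul (tendsto_integral_filter_of_dominated_convergence (fun _ => R)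
    ?_ ?_ (integrable_const _) ?_) _
  · filter_upwards [hH, hyev] with i hi hyi
    exact ((hK.inter_right (H i).closed_of_finiteDimensional).aemeasurable_supportPoint
      (hKH hi.1 hi.2 hyi) (b := b i) (by
        rw [range_const_add_linearIsometry hi.1 hi.2]
        exact inter_subset_right)).aestronglyMeasurable
  · filter_upwards [hH, hyev] with i hi hyi
    exact Eventually.of_forall fun u => hR _
      ((hK.inter_right (H i).closed_of_finiteDimensional).isSupportPoint_supportPoint
        (hKH hi.1 hi.2 hyi) _).1.1
  · filter_upwards [(hK.inter_right H₀.closed_of_finiteDimensional).ae_isSupportPoint_unique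
      (hKH hb₀ hL₀ hy) (b := b₀) (L := L₀) (by
        rw [range_const_add_linearIsometry hb₀ hL₀]; exact inter_subset_right)] with u hu
    exact tendsto_supportPoint hconv hK hb hL hH hb₀ hL₀ hne hu

end Continuity

/-! ### The space of hyperplanes -/

section Hyperplanes

variable {V : Type*} [NormedAddCommGroup V] [InnerProductSpace ℝ V]

/-- The affine hyperplane `{x | ⟪v, x⟫ = t}` with normal vector `v ≠ 0`. -/
noncomputable def hyperplane (v : V) (t : ℝ) : AffineSubspace ℝ V :=
  AffineSubspace.mk' ((t / ‖v‖ ^ 2) • v) (ℝ ∙ v)ᗮ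

theorem direction_hyperplane (v : V) (t : ℝ) : (hyperplane v t).direction = (ℝ ∙ v)ᗮ :=
  AffineSubspace.direction_mk' _ _

theorem smul_mem_hyperplane (v : V) (t : ℝ) : (t / ‖v‖ ^ 2) • v ∈ hyperplane v t :=
  AffineSubspace.self_mem_mk' _ _

theorem mem_hyperplane {v : V} (hv : v ≠ 0) {t : ℝ} {x : V} :
    x ∈ hyperplane v t ↔ ⟪v, x⟫ = t := by
  have hv' : ‖v‖ ^ 2 ≠ 0 := by simpa using hv
  rw [hyperplane, AffineSubspace.mem_mk', Submodule.mem_orthogonal_singleton_iff_inner_right,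
    vsub_eq_sub, inner_sub_right, inner_smul_right, real_inner_self_eq_norm_sq,
    div_mul_cancel₀ _ hv', sub_eq_zero]

theorem hyperplane_smul {v : V} (hv : v ≠ 0) (t : ℝ) {a : ℝ} (ha : a ≠ 0) :
    hyperplane (a • v) (a * t) = hyperplane v t := by
  ext x
  rw [mem_hyperplane hv, mem_hyperplane (smul_ne_zero ha hv), real_inner_smul_left,
    mul_right_inj' ha]

theorem exists_smul_of_hyperplane_eq {v v' : V} (hv : v ≠ 0) (hv' : v' ≠ 0) {t t' : ℝ}
    (h : hyperplane v t = hyperplane v' t') : ∃ a : ℝ, a ≠ 0 ∧ v' = a • v ∧ t' = a * t := by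
  have hdir := congrArg AffineSubspace.direction h
  rw [direction_hyperplane, direction_hyperplane] at hdir
  have hspan : (ℝ ∙ v) = ℝ ∙ v' := by
    rw [← Submodule.orthogonal_orthogonal (ℝ ∙ v), hdir, Submodule.orthogonal_orthogonal]
  obtain ⟨a, rfl⟩ := Submodule.mem_span_singleton.1
    (hspan ▸ Submodule.mem_span_singleton_self v' : v' ∈ ℝ ∙ v)
  refine ⟨a, fun ha => hv' (by simp [ha]), rfl, ?_⟩
  have hx := smul_mem_hyperplane v t
  have hx' := hx
  rw [h, mem_hyperplane hv', real_inner_smul_left, (mem_hyperplane hv).1 hx] at hx'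
  exact hx'.symm

variable [FiniteDimensional ℝ V]

theorem isAffineHyperplane_hyperplane {v : V} (hv : v ≠ 0) (t : ℝ) :
    IsAffineHyperplane (hyperplane v t) := by
  refine ⟨⟨_, smul_mem_hyperplane v t⟩, ?_⟩
  rw [direction_hyperplane, ← Submodule.finrank_add_finrank_orthogonal (ℝ ∙ v),
    finrank_span_singleton hv, add_comm]

/-- The hyperplanes near a given one are parametrized isometrically by the direction of the latter,
in a continuous way. If `v` and `v₀` are unit vectors, then the reflection in the line spanned by
`v + v₀` exchanges them, so it maps the orthogonal complement of `v₀` to that of `v`. -/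
theorem exists_hyperplane_parametrization {v₀ : V} (hv₀ : v₀ ≠ 0) (t₀ : ℝ) :
    ∃ (b : V × ℝ → V) (L : V × ℝ → (ℝ ∙ v₀)ᗮ →ₗᵢ[ℝ] V), ContinuousAt b (v₀, t₀) ∧
      (∀ w, ContinuousAt (fun p => L p w) (v₀, t₀)) ∧
      ∀ p : V × ℝ, p.1 ≠ 0 → b p ∈ hyperplane p.1 p.2 ∧
        (hyperplane p.1 p.2).direction = (L p).toLinearMap.range := by
  let a : V × ℝ → V := fun p => ‖p.1‖⁻¹ • p.1 + ‖v₀‖⁻¹ • v₀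
  let L : V × ℝ → (ℝ ∙ v₀)ᗮ →ₗᵢ[ℝ] V := fun p =>
    (Submodule.reflection (ℝ ∙ a p)).toLinearIsometry.comp (ℝ ∙ v₀)ᗮ.subtypeₗᵢ
  have hL : ∀ p w, L p w = (2 * (⟪a p, (w : V)⟫ / ‖a p‖ ^ 2)) • a p - w := fun p w => by
    have := Submodule.reflection_singleton_apply (𝕜 := ℝ) (a p) (w : V)
    simp only [RCLike.ofReal_real_eq_id, id] at this
    rw [mul_smul, two_smul, ← two_smul ℕ]
    exact this
  have hn₀ : ‖v₀‖ ≠ 0 := norm_ne_zero_iff.2 hv₀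
  refine ⟨fun p => (p.2 / ‖p.1‖ ^ 2) • p.1, L, ?_, fun w => ?_, fun p hp => ⟨
    smul_mem_hyperplane _ _, ?_⟩⟩
  · exact ContinuousAt.smul (continuousAt_snd.div (continuousAt_fst.norm.pow 2)
      (pow_ne_zero 2 hn₀)) continuousAt_fst
  · have ha : ContinuousAt a (v₀, t₀) :=
      ((continuousAt_fst.norm.inv₀ hn₀).smul continuousAt_fst).add continuousAt_const
    have ha₀ : ‖a (v₀, t₀)‖ ^ 2 ≠ 0 := by
      have : a (v₀, t₀) = (2 * ‖v₀‖⁻¹) • v₀ := by simp only [a]; module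
      rw [this]
      simp [norm_smul, hv₀]
    simp only [hL]
    exact ((continuousAt_const.mul ((ha.inner continuousAt_const).div (ha.norm.pow 2)
      ha₀)).smul ha).sub continuousAt_const
  · rw [direction_hyperplane]
    symm
    have hrank : ∀ {v : V}, v ≠ 0 → finrank ℝ (ℝ ∙ v)ᗮ + 1 = finrank ℝ V := fun {v} hv => by
      rw [← direction_hyperplane v 0]
      exact (isAffineHyperplane_hyperplane hv 0).2
    refine Submodule.eq_of_le_of_finrank_eq ?_ ?_
    · rintro _ ⟨w, rfl⟩
      rw [Submodule.mem_orthogonal_singleton_iff_inner_right]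
      change ⟪p.1, L p w⟫ = 0
      have hw := Submodule.mem_orthogonal_singleton_iff_inner_right.1 w.2
      have hn : ‖p.1‖ ≠ 0 := norm_ne_zero_iff.2 hp
      set e := ‖p.1‖⁻¹ • p.1 with he
      set e₀ := ‖v₀‖⁻¹ • v₀ with he₀
      have hp1 : p.1 = ‖p.1‖ • e := by rw [he, smul_inv_smul₀ hn]
      have hee : ⟪e, e⟫ = 1 := by
        rw [real_inner_self_eq_norm_sq, he, norm_smul]; simp [hn]
      have he₀e₀ : ⟪e₀, e₀⟫ = 1 := by
        rw [real_inner_self_eq_norm_sq, he₀, norm_smul]; simp [hn₀]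
      have he₀w : ⟪e₀, (w : V)⟫ = 0 := by rw [he₀, real_inner_smul_left, hw, mul_zero]
      have hap : a p = e + e₀ := rfl
      have haw : ⟪a p, (w : V)⟫ = ⟪e, (w : V)⟫ := by rw [hap, inner_add_left, he₀w, add_zero]
      have hea : ⟪e, a p⟫ = 1 + ⟪e, e₀⟫ := by rw [hap, inner_add_right, hee]
      have haa : ‖a p‖ ^ 2 = 2 * (1 + ⟪e, e₀⟫) := by
        rw [← real_inner_self_eq_norm_sq, hap, inner_add_left, inner_add_right, inner_add_right,
          hee, he₀e₀, real_inner_comm]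
        ring
      rw [hp1, real_inner_smul_left, hL, inner_sub_right, inner_smul_right, hea, haw, haa]
      by_cases h0 : 1 + ⟪e, e₀⟫ = 0
      · have ha0 : a p = 0 := by simpa [h0] using haa
        rw [← haw, ha0]
        simp
      · field_simp
        ring
    · rw [LinearMap.finrank_range_of_inj (L p).injective]
      have := hrank hp
      have := hrank hv₀
      omega

variable [MeasurableSpace V] [BorelSpace V]

/-- `P` selects, for every hyperplane that meets the interior of `K`, a point of this hyperplane
in the interior of `K`, depending continuously on the hyperplane. -/
structure IsSectionPoint (K : Set V) (P : AffineSubspace ℝ V → V) : Prop where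
  mem : ∀ {v : V} {t : ℝ}, v ≠ 0 → ((hyperplane v t : Set V) ∩ interior K).Nonempty →
    P (hyperplane v t) ∈ (hyperplane v t : Set V) ∩ interior K
  continuousAt : ∀ {v : V} {t : ℝ}, v ≠ 0 → ((hyperplane v t : Set V) ∩ interior K).Nonempty →
    ContinuousAt (fun p : V × ℝ => P (hyperplane p.1 p.2)) (v, t)

variable {K : Set V}

theorem isSectionPoint_sectionCentroid (hconv : Convex ℝ K) (hK : IsCompact K) :
    IsSectionPoint K (sectionCentroid K) where
  mem {v t} hv hne := by
    obtain ⟨b, L, -, -, h⟩ := exists_hyperplane_parametrization hv t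
    exact sectionCentroid_mem hconv hK (h (v, t) hv).1 (h (v, t) hv).2 hne
  continuousAt {v t} hv hne := by
    obtain ⟨b, L, hb, hL, h⟩ := exists_hyperplane_parametrization hv t
    exact tendsto_sectionCentroid hconv hK hb hL
      ((continuousAt_fst.eventually_ne hv).mono fun p hp => h p hp) (h (v, t) hv).1
      (h (v, t) hv).2 hne

theorem isSectionPoint_sectionSteinerPoint (hconv : Convex ℝ K) (hK : IsCompact K) :
    IsSectionPoint K (sectionSteinerPoint K) where
  mem {v t} hv hne := by
    obtain ⟨b, L, -, -, h⟩ := exists_hyperplane_parametrization hv t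
    exact sectionSteinerPoint_mem hconv hK (h (v, t) hv).1 (h (v, t) hv).2 hne
  continuousAt {v t} hv hne := by
    obtain ⟨b, L, hb, hL, h⟩ := exists_hyperplane_parametrization hv t
    exact tendsto_sectionSteinerPoint hconv hK hb hL
      ((continuousAt_fst.eventually_ne hv).mono fun p hp => h p hp) (h (v, t) hv).1
      (h (v, t) hv).2 hne

end Hyperplanes

/-! ### Maps on projective space, and linear hyperplanes -/

section Projective

variable {V : Type*} [NormedAddCommGroup V] [InnerProductSpace ℝ V]

/-- A function on the nonzero vectors that is continuous and invariant under scaling descends to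
projective space. -/
theorem exists_continuousMap_projectivization {X : Type*} [TopologicalSpace X] (F : V → X)
    (hF : ∀ v, v ≠ 0 → ContinuousAt F v)
    (hsmul : ∀ (a : ℝ) (v : V), a ≠ 0 → v ≠ 0 → F (a • v) = F v) :
    ∃ f : C(Projectivization ℝ V, X), ∀ x, f x = F x.rep := by
  have hlift : ∀ (a b : {v : V // v ≠ 0}) (t : ℝ), (a : V) = t • (b : V) → F a = F b := by
    intro a b t h
    have ht : t ≠ 0 := fun ht => a.2 (by simp [h, ht])
    rw [h, hsmul t b ht b.2]
  refine ⟨⟨Projectivization.lift (fun v : {v : V // v ≠ 0} => F v) hlift, ?_⟩, fun x => ?_⟩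
  · refine continuous_coinduced_dom.2 ?_
    change Continuous fun v : {v : V // v ≠ 0} => F v
    exact continuous_iff_continuousAt.2 fun v => (hF v v.2).comp continuousAt_subtype_val
  · conv_lhs => rw [← x.mk_rep]
    rfl

theorem Projectivization.eq_of_rep_eq_smul {x y : Projectivization ℝ V} {a : ℝ}
    (h : x.rep = a • y.rep) : x = y := by
  rw [← x.mk_rep, ← y.mk_rep, Projectivization.mk_eq_mk_iff']
  exact ⟨a, h.symm⟩

variable [FiniteDimensional ℝ V]

/-- The map that sends the line spanned by `v` to the selected point of the linear hyperplane
orthogonal to `v`. -/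
theorem IsSectionPoint.exists_continuousMap_linear {K : Set V} {P : AffineSubspace ℝ V → V}
    (hP : IsSectionPoint K P) (h0 : (0 : V) ∈ interior K) :
    ∃ f : C(Projectivization ℝ V, V), ∀ k : ℕ, AdmitsMultiplicity f k →
      ∃ H : Fin k → AffineSubspace ℝ V, Function.Injective H ∧
        (∀ i, IsLinearHyperplane (H i)) ∧ ∀ i j, P (H i) = P (H j) := by
  have hmem : ∀ {v : V}, v ≠ 0 → (0 : V) ∈ hyperplane v 0 := fun {v} hv => by
    rw [mem_hyperplane hv, inner_zero_right]
  obtain ⟨f, hf⟩ := exists_continuousMap_projectivization (fun v : V => P (hyperplane v 0))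
    (fun v hv => ContinuousAt.comp (f := fun v : V => (v, (0 : ℝ)))
      (hP.continuousAt hv ⟨0, hmem hv, h0⟩) (by fun_prop))
    (fun a v ha hv => by simpa using congrArg P (hyperplane_smul hv 0 ha))
  refine ⟨f, fun k ⟨x, hx, hfx⟩ => ⟨fun i => hyperplane (x i).rep 0, fun i j hij => ?_, fun i => ?_,
    fun i j => ?_⟩⟩
  · obtain ⟨a, -, ha, -⟩ := exists_smul_of_hyperplane_eq (x i).rep_nonzero (x j).rep_nonzero hij
    exact (hx (Projectivization.eq_of_rep_eq_smul ha)).symm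
  · exact ⟨isAffineHyperplane_hyperplane (x i).rep_nonzero 0, hmem (x i).rep_nonzero⟩
  · simpa only [hf] using hfx i j

end Projective

/-! ### The sphere as a convex body with collapsed boundary -/

section SphereCoordinates

variable {m : ℕ}

/-- The first `m` coordinates of a vector of `ℝ^(m + 1)`. -/
noncomputable def initCoords (z : EuclideanSpace ℝ (Fin (m + 1))) : EuclideanSpace ℝ (Fin m) :=
  WithLp.toLp 2 fun i => z i.castSucc

/-- The vector of `ℝ^(m + 1)` with first coordinates `x` and last coordinate `t`. -/
noncomputable def snocCoords (x : EuclideanSpace ℝ (Fin m)) (t : ℝ) :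
    EuclideanSpace ℝ (Fin (m + 1)) :=
  WithLp.toLp 2 (Fin.snoc x t : Fin (m + 1) → ℝ)

theorem initCoords_smul (a : ℝ) (z : EuclideanSpace ℝ (Fin (m + 1))) :
    initCoords (a • z) = a • initCoords z := rfl

theorem continuous_initCoords :
    Continuous (initCoords : EuclideanSpace ℝ (Fin (m + 1)) → EuclideanSpace ℝ (Fin m)) := by
  unfold initCoords
  fun_prop

theorem eq_of_initCoords_eq {z z' : EuclideanSpace ℝ (Fin (m + 1))}
    (h : initCoords z = initCoords z') (hl : z (Fin.last m) = z' (Fin.last m)) : z = z' := by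
  ext i
  refine Fin.lastCases hl (fun j => ?_) i
  exact congrArg (fun x : EuclideanSpace ℝ (Fin m) => x j) h

theorem initCoords_snocCoords (x : EuclideanSpace ℝ (Fin m)) (t : ℝ) :
    initCoords (snocCoords x t) = x := by
  ext i
  simp [initCoords, snocCoords]

theorem snocCoords_last (x : EuclideanSpace ℝ (Fin m)) (t : ℝ) :
    snocCoords x t (Fin.last m) = t := by
  simp [snocCoords]

theorem norm_sq_snocCoords (x : EuclideanSpace ℝ (Fin m)) (t : ℝ) :
    ‖snocCoords x t‖ ^ 2 = ‖x‖ ^ 2 + t ^ 2 := by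
  rw [EuclideanSpace.norm_sq_eq, EuclideanSpace.norm_sq_eq, Fin.sum_univ_castSucc]
  simp [snocCoords]

theorem continuous_snocCoords :
    Continuous fun p : EuclideanSpace ℝ (Fin m) × ℝ => snocCoords p.1 p.2 := by
  refine (PiLp.continuous_toLp 2 _).comp (continuous_pi fun i => ?_)
  refine Fin.lastCases ?_ (fun j => ?_) i
  · simpa using continuous_snd
  · simp only [Fin.snoc_castSucc]
    fun_prop

/-- A convex body modulo its boundary is a sphere. With `y = x - x₀` for an interior point `x₀` and
`ρ = 1 - gauge (K - x₀) y`, which vanishes on the boundary, the map is the inverse of the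
stereographic projection, applied to `y / ρ`. -/
theorem exists_collapse_frontier {K : Set (EuclideanSpace ℝ (Fin m))} (hconv : Convex ℝ K)
    (hne : (interior K).Nonempty) :
    ∃ (g : EuclideanSpace ℝ (Fin m) → UnitSphereOf (m + 1)) (q : UnitSphereOf (m + 1)),
      Continuous g ∧ InjOn g (interior K) ∧ (∀ x ∈ frontier K, g x = q) ∧
        ∀ x ∈ interior K, g x ≠ q := by
  obtain ⟨x₀, hx₀⟩ := hne
  let K₀ : Set (EuclideanSpace ℝ (Fin m)) := (Homeomorph.addRight x₀) ⁻¹' K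
  have hconv₀ : Convex ℝ K₀ := hconv.translate_preimage_left x₀
  have hK₀ : K₀ ∈ 𝓝 0 := (Homeomorph.addRight x₀).continuous.continuousAt.preimage_mem_nhds
    (by simpa using mem_interior_iff_mem_nhds.1 hx₀)
  let ρ : EuclideanSpace ℝ (Fin m) → ℝ := fun x => 1 - gauge K₀ (x - x₀)
  have hρ : Continuous ρ :=
    continuous_const.sub ((continuous_gauge hconv₀ hK₀).comp (by fun_prop))
  have hρint : ∀ x ∈ interior K, 0 < ρ x := by
    intro x hx
    refine sub_pos.2 ((gauge_lt_one_iff_mem_interior hconv₀ hK₀).2 ?_)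
    rw [← Homeomorph.preimage_interior]
    simpa using hx
  have hρfr : ∀ x ∈ frontier K, ρ x = 0 := by
    intro x hx
    refine sub_eq_zero.2 ((gauge_eq_one_iff_mem_frontier hconv₀ hK₀).2 ?_).symm
    rw [← Homeomorph.preimage_frontier]
    simpa using hx
  let N : EuclideanSpace ℝ (Fin m) → ℝ := fun x => ‖x - x₀‖ ^ 2 + ρ x ^ 2
  have hN : ∀ x, 0 < N x := by
    intro x
    rcases eq_or_ne x x₀ with rfl | hx
    · simp [N, ρ]
    · have : 0 < ‖x - x₀‖ := norm_pos_iff.2 (sub_ne_zero.2 hx)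
      positivity
  have hNc : Continuous N := by fun_prop
  let G : EuclideanSpace ℝ (Fin m) → EuclideanSpace ℝ (Fin (m + 1)) := fun x =>
    snocCoords ((2 * ρ x / N x) • (x - x₀)) ((‖x - x₀‖ ^ 2 - ρ x ^ 2) / N x)
  have hGc : Continuous G := by
    refine continuous_snocCoords.comp (Continuous.prodMk ?_ ?_)
    · exact ((continuous_const.mul hρ).div hNc fun x => (hN x).ne').smul (by fun_prop)
    · exact Continuous.div (by fun_prop) hNc fun x => (hN x).ne'
  have hGn : ∀ x, G x ∈ Metric.sphere (0 : EuclideanSpace ℝ (Fin (m + 1))) 1 := by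
    intro x
    rw [mem_sphere_zero_iff_norm, ← sq_eq_sq₀ (norm_nonneg _) zero_le_one, norm_sq_snocCoords,
      norm_smul, Real.norm_eq_abs, mul_pow, sq_abs, div_pow, div_pow, div_mul_eq_mul_div,
      ← add_div, div_eq_iff (pow_ne_zero 2 (hN x).ne')]
    simp only [N]
    ring
  have hlast : ∀ x, G x (Fin.last m) = 1 - 2 * (ρ x ^ 2 / N x) := by
    intro x
    have := (hN x).ne'
    simp only [G, snocCoords_last]
    field_simp
    simp only [N]
    ring
  have hq : snocCoords (0 : EuclideanSpace ℝ (Fin m)) 1 ∈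
      Metric.sphere (0 : EuclideanSpace ℝ (Fin (m + 1))) 1 := by
    rw [mem_sphere_zero_iff_norm, ← sq_eq_sq₀ (norm_nonneg _) zero_le_one, norm_sq_snocCoords]
    simp
  refine ⟨fun x => ⟨G x, hGn x⟩, ⟨_, hq⟩, hGc.subtype_mk _, fun x hx x' hx' h => ?_,
    fun x hx => Subtype.ext ?_, fun x hx h => ?_⟩
  · have hG : G x = G x' := congrArg Subtype.val h
    have hr := hρint x hx
    have hr' := hρint x' hx'
    have h1 := congrArg (fun z : EuclideanSpace ℝ (Fin (m + 1)) => z (Fin.last m)) hG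
    simp only [hlast] at h1
    have h1 : ρ x ^ 2 / N x = ρ x' ^ 2 / N x' := by linarith
    have h2 := congrArg initCoords hG
    simp only [G, initCoords_snocCoords] at h2
    -- Both points lie on one ray from `x₀`, and on a ray the gauge is linear.
    have hray : x - x₀ = (ρ x / ρ x') • (x' - x₀) := by
      have hc := (hN x).ne'
      have hc' := (hN x').ne'
      have h3 : (2 * (ρ x ^ 2 / N x)) • (x - x₀) =
          (2 * (ρ x ^ 2 / N x)) • ((ρ x / ρ x') • (x' - x₀)) := by
        have e1 : 2 * (ρ x ^ 2 / N x) = ρ x * (2 * ρ x / N x) := by ring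
        have e2 : ρ x * (2 * ρ x' / N x') = 2 * (ρ x' ^ 2 / N x') * (ρ x / ρ x') := by
          field_simp
        rw [smul_smul]
        nth_rewrite 2 [h1]
        rw [← e2, e1, mul_smul, h2, smul_smul]
      exact smul_right_injective _ (by positivity) h3
    have hratio : ρ x / ρ x' = 1 := by
      have hg : gauge K₀ (x - x₀) = ρ x / ρ x' * gauge K₀ (x' - x₀) := by
        rw [hray, gauge_smul_of_nonneg (div_pos hr hr').le, smul_eq_mul]
      have hg1 : gauge K₀ (x - x₀) = 1 - ρ x := by simp [ρ]
      have hg2 : gauge K₀ (x' - x₀) = 1 - ρ x' := by simp [ρ]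
      rw [hg1, hg2, mul_sub, div_mul_cancel₀ _ hr'.ne'] at hg
      linarith
    rw [hratio, one_smul] at hray
    exact sub_left_injective hray
  · have hN0 := (hN x).ne'
    have h0 := hρfr x hx
    simp only [G]
    rw [h0]
    simp only [N, h0] at hN0 ⊢
    congr 1
    · simp
    · rw [div_eq_one_iff_eq hN0]
      ring
  · have h1 := congrArg (fun z : UnitSphereOf (m + 1) =>
      (z : EuclideanSpace ℝ (Fin (m + 1))) (Fin.last m)) h
    simp only [hlast, snocCoords_last] at h1
    have := div_pos (pow_pos (hρint x hx) 2) (hN x)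
    linarith

end SphereCoordinates

/-! ### The hyperplanes that meet the interior -/

section Offset

variable {V : Type*} [NormedAddCommGroup V] [InnerProductSpace ℝ V] {K : Set V}

theorem IsCompact.inner_lt_supportFunction (hK : IsCompact K) {v x : V} (hv : v ≠ 0)
    (hx : x ∈ interior K) : ⟪v, x⟫ < supportFunction K v := by
  have hc : ContinuousAt (fun ε : ℝ => x + ε • v) 0 := by fun_prop
  have hev : ∀ᶠ ε : ℝ in 𝓝 0, x + ε • v ∈ K :=
    hc.eventually_mem (by simpa using mem_interior_iff_mem_nhds.1 hx)
  obtain ⟨ε, hεK, hε⟩ := ((hev.filter_mono nhdsWithin_le_nhds).and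
    (self_mem_nhdsWithin : Ioi (0 : ℝ) ∈ 𝓝[>] 0)).exists
  have h1 := hK.inner_le_supportFunction v hεK
  have h2 : 0 < ε * ⟪v, v⟫ := mul_pos hε (real_inner_self_pos.2 hv)
  rw [inner_add_right, inner_smul_right] at h1
  linarith

theorem hyperplane_inter_interior_nonempty (hconv : Convex ℝ K) (hK : IsCompact K)
    (hne : (interior K).Nonempty) {v : V} (hv : v ≠ 0) {t : ℝ} (h1 : -supportFunction K (-v) < t)
    (h2 : t < supportFunction K v) : ((hyperplane v t : Set V) ∩ interior K).Nonempty := by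
  have hex : ∀ {v : V} {t : ℝ}, t < supportFunction K v → ∃ x ∈ interior K, t < ⟪v, x⟫ := by
    intro v t ht
    obtain ⟨x, hx⟩ := hK.exists_isSupportPoint (hne.mono interior_subset) v
    rw [hx.supportFunction_eq] at ht
    have hcl : x ∈ closure (interior K) := by
      rw [hconv.closure_interior_eq_closure_of_nonempty_interior hne]
      exact subset_closure hx.1
    obtain ⟨y, hy, hyK⟩ := mem_closure_iff.1 hcl {y | t < ⟪v, y⟫}
      (isOpen_lt continuous_const (by fun_prop)) ht
    exact ⟨y, hyK, hy⟩
  obtain ⟨x, hx, hxt⟩ := hex h2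
  obtain ⟨y, hy, hyt⟩ := hex (show -t < supportFunction K (-v) by linarith)
  rw [inner_neg_left] at hyt
  obtain ⟨z, hz, hzt⟩ := hconv.interior.isPreconnected.intermediate_value hy hx
    (f := fun x => ⟪v, x⟫) (by fun_prop) ⟨by linarith, hxt.le⟩
  exact ⟨z, (mem_hyperplane hv).2 hzt, hz⟩

/-- The distance of a point of `K` to the complement of `K` is at most its distance to the supporting
hyperplane with outer normal `v`. -/
theorem infDist_compl_le {v x : V} {t : ℝ} (hK : IsCompact K) (hv : v ≠ 0) (hx : x ∈ K)
    (hxt : ⟪v, x⟫ = t) : Metric.infDist x Kᶜ ≤ (supportFunction K v - t) / ‖v‖ := by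
  have hn : 0 < ‖v‖ := norm_pos_iff.2 hv
  have hle := hK.inner_le_supportFunction v hx
  rw [hxt] at hle
  refine le_of_forall_pos_le_add fun ε hε => ?_
  set c := (supportFunction K v - t) / ‖v‖ + ε with hc
  have hc0 : 0 < c := add_pos_of_nonneg_of_pos (div_nonneg (sub_nonneg.2 hle) hn.le) hε
  have hmem : x + (c / ‖v‖) • v ∈ Kᶜ := by
    intro h
    have h1 := hK.inner_le_supportFunction v h
    rw [inner_add_right, inner_smul_right, real_inner_self_eq_norm_sq, hxt] at h1
    have h2 : c / ‖v‖ * ‖v‖ ^ 2 = supportFunction K v - t + ε * ‖v‖ := by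
      rw [hc]; field_simp
    have h3 := mul_pos hε hn
    linarith
  refine (Metric.infDist_le_dist_of_mem hmem).trans_eq ?_
  rw [dist_self_add_right, norm_smul, Real.norm_eq_abs, abs_of_pos (div_pos hc0 hn),
    div_mul_cancel₀ _ hn.ne']

/-- Half the width of `K` in the direction `v`, times `‖v‖`. -/
noncomputable def halfWidth (K : Set V) (v : V) : ℝ :=
  (supportFunction K v + supportFunction K (-v)) / 2

/-- For `v ≠ 0`, this is an increasing bijection of `s ∈ ℝ` to the interval of all `t` such that
the hyperplane `{x | ⟪v, x⟫ = t}` meets the interior of `K`. It is homogeneous: multiplying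
both `v` and `s` with `a` multiplies the value with `a`. -/
noncomputable def hyperplaneOffset (K : Set V) (v : V) (s : ℝ) : ℝ :=
  (supportFunction K v - supportFunction K (-v)) / 2 + halfWidth K v * (s / (‖v‖ + |s|))

theorem hyperplaneOffset_smul (hK : IsCompact K) (hne : K.Nonempty) (v : V) (s a : ℝ) :
    hyperplaneOffset K (a • v) (a * s) = a * hyperplaneOffset K v s := by
  rcases eq_or_ne a 0 with rfl | ha
  · simp [hyperplaneOffset]
  have hden : a * s / (‖a • v‖ + |a * s|) = a / |a| * (s / (‖v‖ + |s|)) := by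
    rw [norm_smul, Real.norm_eq_abs, abs_mul, ← mul_add, mul_div_mul_comm]
  simp only [hyperplaneOffset, halfWidth, hden]
  rcases ha.lt_or_gt with h | h
  · have e1 : a • v = (-a) • (-v) := by simp
    have e2 : -(a • v) = (-a) • v := by simp
    have h' : (0 : ℝ) ≤ -a := by linarith
    rw [e2, e1, hK.supportFunction_smul hne h', hK.supportFunction_smul hne h', abs_of_neg h,
      div_neg, div_self ha]
    ring
  · rw [← smul_neg, hK.supportFunction_smul hne h.le, hK.supportFunction_smul hne h.le,
      abs_of_pos h, div_self ha]
    ring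

theorem halfWidth_pos (hK : IsCompact K) (hne : (interior K).Nonempty) {v : V} (hv : v ≠ 0) :
    0 < halfWidth K v := by
  obtain ⟨x, hx⟩ := hne
  have h1 := hK.inner_lt_supportFunction hv hx
  have h2 := hK.inner_lt_supportFunction (neg_ne_zero.2 hv) hx
  rw [inner_neg_left] at h2
  rw [halfWidth]
  linarith

theorem supportFunction_sub_hyperplaneOffset {v : V} (hv : v ≠ 0) (s : ℝ) :
    supportFunction K v - hyperplaneOffset K v s =
      halfWidth K v * ((‖v‖ + |s| - s) / (‖v‖ + |s|)) := by
  have hn : ‖v‖ + |s| ≠ 0 := (add_pos_of_pos_of_nonneg (norm_pos_iff.2 hv) (abs_nonneg s)).ne'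
  rw [sub_div, div_self hn, hyperplaneOffset, halfWidth]
  ring

theorem supportFunction_neg_add_hyperplaneOffset {v : V} (hv : v ≠ 0) (s : ℝ) :
    supportFunction K (-v) + hyperplaneOffset K v s =
      halfWidth K v * ((‖v‖ + |s| + s) / (‖v‖ + |s|)) := by
  have hn : ‖v‖ + |s| ≠ 0 := (add_pos_of_pos_of_nonneg (norm_pos_iff.2 hv) (abs_nonneg s)).ne'
  rw [add_div, div_self hn, hyperplaneOffset, halfWidth]
  ring

theorem hyperplane_hyperplaneOffset_inter_nonempty (hconv : Convex ℝ K) (hK : IsCompact K)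
    (hne : (interior K).Nonempty) {v : V} (hv : v ≠ 0) (s : ℝ) :
    ((hyperplane v (hyperplaneOffset K v s) : Set V) ∩ interior K).Nonempty := by
  have hw := halfWidth_pos hK hne hv
  have hn : 0 < ‖v‖ := norm_pos_iff.2 hv
  have hd : 0 < ‖v‖ + |s| := add_pos_of_pos_of_nonneg hn (abs_nonneg s)
  have h1 := supportFunction_sub_hyperplaneOffset (K := K) hv s
  have h2 := supportFunction_neg_add_hyperplaneOffset (K := K) hv s
  have h3 : 0 < ‖v‖ + |s| - s := by linarith [le_abs_self s]
  have h4 : 0 < ‖v‖ + |s| + s := by linarith [neg_abs_le s]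
  have h5 := mul_pos hw (div_pos h3 hd)
  have h6 := mul_pos hw (div_pos h4 hd)
  exact hyperplane_inter_interior_nonempty hconv hK hne hv (by linarith) (by linarith)

theorem hyperplaneOffset_injective (hK : IsCompact K) (hne : (interior K).Nonempty) {v : V}
    (hv : v ≠ 0) : Function.Injective (hyperplaneOffset K v) := by
  intro s s' h
  have hn : 0 < ‖v‖ := norm_pos_iff.2 hv
  have hd : ∀ s, 0 < ‖v‖ + |s| := fun s => add_pos_of_pos_of_nonneg hn (abs_nonneg s)
  have h1 : s / (‖v‖ + |s|) = s' / (‖v‖ + |s'|) :=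
    mul_left_cancel₀ (halfWidth_pos hK hne hv).ne' (add_left_cancel h)
  rw [div_eq_div_iff (hd s).ne' (hd s').ne'] at h1
  have h2 : s * |s'| = s' * |s| := by
    rcases le_total 0 s with hs | hs <;> rcases le_total 0 s' with hs' | hs' <;>
      simp only [abs_of_nonneg, abs_of_nonpos, hs, hs'] at h1 ⊢ <;> nlinarith
  nlinarith

/-- As `v` tends to zero, the hyperplane with normal vector `v` and offset
`hyperplaneOffset K v s` approaches a supporting hyperplane, unless `s` tends to zero too. -/
theorem infDist_compl_le_of_mem_hyperplane (hK : IsCompact K) {v : V}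
    (hv : v ≠ 0) (s : ℝ) {x : V} (hx : x ∈ K)
    (hxH : x ∈ hyperplane v (hyperplaneOffset K v s)) :
    Metric.infDist x Kᶜ ≤ halfWidth K v / (‖v‖ + |s|) := by
  have hn : 0 < ‖v‖ := norm_pos_iff.2 hv
  rw [mem_hyperplane hv] at hxH
  have hd : ‖v‖ + |s| ≠ 0 := (add_pos_of_pos_of_nonneg hn (abs_nonneg s)).ne'
  rcases le_total 0 s with hs | hs
  · have h := infDist_compl_le hK hv hx hxH
    rwa [supportFunction_sub_hyperplaneOffset hv, abs_of_nonneg hs, add_sub_cancel_right,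
      mul_div_assoc, div_right_comm, div_self hn.ne', mul_one_div, ← abs_of_nonneg hs] at h
  · have h := infDist_compl_le hK (neg_ne_zero.2 hv) hx
      (t := -hyperplaneOffset K v s) (by rw [inner_neg_left, hxH])
    rwa [sub_neg_eq_add, supportFunction_neg_add_hyperplaneOffset hv, norm_neg, abs_of_nonpos hs,
      neg_add_cancel_right, mul_div_assoc, div_right_comm, div_self hn.ne', mul_one_div,
      ← abs_of_nonpos hs] at h

end Offset

/-! ### Affine hyperplanes -/

section Affine

variable {m : ℕ} {K : Set (EuclideanSpace ℝ (Fin m))}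
  {P : AffineSubspace ℝ (EuclideanSpace ℝ (Fin m)) → EuclideanSpace ℝ (Fin m)}

/-- A map that is constant on the boundary of a compact set converges to this constant along points
of the set that approach the boundary. -/
theorem IsCompact.tendsto_of_infDist_compl {ι X Y : Type*} [MetricSpace X] [TopologicalSpace Y]
    {K : Set X} (hK : IsCompact K) (hKc : Kᶜ.Nonempty) {g : X → Y} (hg : Continuous g) {q : Y}
    (hq : ∀ x ∈ frontier K, g x = q) {l : Filter ι} {x : ι → X} (hx : ∀ᶠ i in l, x i ∈ K)
    (hd : Tendsto (fun i => Metric.infDist (x i) Kᶜ) l (𝓝 0)) :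
    Tendsto (fun i => g (x i)) l (𝓝 q) := by
  rw [tendsto_iff_ultrafilter]
  intro G hG
  obtain ⟨y, hyK, hy⟩ := hK.ultrafilter_le_nhds (G.map x) (le_principal_iff.2 (hG hx))
  have hy : Tendsto x G (𝓝 y) := hy
  have hy0 : Metric.infDist y Kᶜ = 0 := tendsto_nhds_unique
    (((Metric.continuous_infDist_pt _).tendsto y).comp hy) (hd.mono_left hG)
  rw [← Metric.mem_closure_iff_infDist_zero hKc] at hy0
  have hyfr : y ∈ frontier K := by
    rw [frontier_eq_closure_inter_closure]
    exact ⟨subset_closure hyK, hy0⟩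
  rw [← hq y hyfr]
  exact (hg.tendsto y).comp hy

/-- The projective space without the point `[0 : 1]` parametrizes the hyperplanes that meet the
interior of `K`, and the section points tend to the boundary of `K` at `[0 : 1]`. Collapsing the
boundary of `K` to a point of the sphere gives the map, whose value at `[0 : 1]` is not attained
elsewhere. -/
theorem IsSectionPoint.exists_continuousMap_affine (hP : IsSectionPoint K P) (hm : 1 ≤ m)
    (hconv : Convex ℝ K) (hK : IsCompact K) (hne : (interior K).Nonempty) :
    ∃ f : C(RPOf (m + 1), UnitSphereOf (m + 1)), ∀ k : ℕ, AdmitsMultiplicity f k →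
      ∃ H : Fin k → AffineSubspace ℝ (EuclideanSpace ℝ (Fin m)), Function.Injective H ∧
        (∀ i, IsAffineHyperplane (H i) ∧ ((H i : Set _) ∩ interior K).Nonempty) ∧
        ∀ i j, P (H i) = P (H j) := by
  classical
  obtain ⟨g, q, hg, hginj, hgfr, hgint⟩ := exists_collapse_frontier hconv hne
  have hneK := hne.mono interior_subset
  have hnt : Nontrivial (EuclideanSpace ℝ (Fin m)) := by
    have : Nonempty (Fin m) := ⟨⟨0, hm⟩⟩
    infer_instance
  have hKc : Kᶜ.Nonempty := nonempty_compl.2 hK.ne_univ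
  have hsc : Continuous (supportFunction K) := by
    obtain ⟨R, hR⟩ := hK.lipschitzWith_supportFunction hneK
    exact hR.continuous
  have hwc : Continuous (halfWidth K) := by unfold halfWidth; fun_prop
  let Hyp : EuclideanSpace ℝ (Fin (m + 1)) → AffineSubspace ℝ (EuclideanSpace ℝ (Fin m)) :=
    fun z => hyperplane (initCoords z) (hyperplaneOffset K (initCoords z) (z (Fin.last m)))
  have hmeet : ∀ {z}, initCoords z ≠ 0 → ((Hyp z : Set _) ∩ interior K).Nonempty :=
    fun hz => hyperplane_hyperplaneOffset_inter_nonempty hconv hK hne hz _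
  have hPmem : ∀ {z}, initCoords z ≠ 0 → P (Hyp z) ∈ (Hyp z : Set _) ∩ interior K :=
    fun hz => hP.mem hz (hmeet hz)
  let F : EuclideanSpace ℝ (Fin (m + 1)) → UnitSphereOf (m + 1) := fun z =>
    if initCoords z = 0 then q else g (P (Hyp z))
  have hFcont : ∀ z, z ≠ 0 → ContinuousAt F z := by
    intro z hz
    have hic : ContinuousAt initCoords z := continuous_initCoords.continuousAt
    have hlc : ContinuousAt (fun z : EuclideanSpace ℝ (Fin (m + 1)) => z (Fin.last m)) z := by
      fun_prop
    by_cases hv : initCoords z = 0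
    · have hs : z (Fin.last m) ≠ 0 := fun h =>
        hz (eq_of_initCoords_eq (by rw [hv]; rfl) h)
      have hFz : F z = q := if_pos hv
      rw [ContinuousAt, hFz]
      refine tendsto_const_nhds.if ?_
      have hev : ∀ᶠ z' in 𝓝 z ⊓ 𝓟 {z' | ¬ initCoords z' = 0}, initCoords z' ≠ 0 :=
        mem_inf_of_right (mem_principal_self _)
      refine hK.tendsto_of_infDist_compl hKc hg hgfr
        (hev.mono fun z' hz' => interior_subset (hPmem hz').2) ?_
      have hlim : Tendsto (fun z' : EuclideanSpace ℝ (Fin (m + 1)) =>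
          halfWidth K (initCoords z') / (‖initCoords z'‖ + |z' (Fin.last m)|)) (𝓝 z) (𝓝 0) := by
        have h0 : halfWidth K (initCoords z) / (‖initCoords z‖ + |z (Fin.last m)|) = 0 := by
          have := hK.supportFunction_smul hneK le_rfl (0 : EuclideanSpace ℝ (Fin m))
          rw [zero_smul, zero_mul] at this
          simp [halfWidth, hv, this]
        rw [← h0]
        exact ((hwc.tendsto _).comp hic).div (hic.norm.add hlc.abs) (by simp [hv, hs])
      refine squeeze_zero' (Eventually.of_forall fun _ => Metric.infDist_nonneg)
        (hev.mono fun z' hz' => ?_) (hlim.mono_left inf_le_left)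
      exact infDist_compl_le_of_mem_hyperplane hK hz' _ (interior_subset (hPmem hz').2)
        (hPmem hz').1
    · have hoff : ContinuousAt (fun z : EuclideanSpace ℝ (Fin (m + 1)) =>
          (initCoords z, hyperplaneOffset K (initCoords z) (z (Fin.last m)))) z := by
        refine hic.prodMk ?_
        have hd : ‖initCoords z‖ + |z (Fin.last m)| ≠ 0 :=
          (add_pos_of_pos_of_nonneg (norm_pos_iff.2 hv) (abs_nonneg _)).ne'
        have h1 := hsc.continuousAt.comp hic
        have h2 := hsc.continuousAt.comp hic.neg
        have h3 := hwc.continuousAt.comp hic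
        exact ((h1.sub h2).div_const 2).add (h3.mul (hlc.div (hic.norm.add hlc.abs) hd))
      have hPc : ContinuousAt (fun z => P (Hyp z)) z :=
        ContinuousAt.comp (f := fun z : EuclideanSpace ℝ (Fin (m + 1)) =>
          (initCoords z, hyperplaneOffset K (initCoords z) (z (Fin.last m))))
          (hP.continuousAt hv (hmeet hv)) hoff
      refine (hg.continuousAt.comp hPc).congr ?_
      filter_upwards [hic.eventually_ne hv] with z' hz'
      exact (if_neg hz').symm
  have hFsmul : ∀ (a : ℝ) (z : EuclideanSpace ℝ (Fin (m + 1))), a ≠ 0 → z ≠ 0 →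
      F (a • z) = F z := by
    intro a z ha _
    by_cases hv : initCoords z = 0
    · simp only [F, initCoords_smul, hv, smul_zero, if_true]
    · have hav : initCoords (a • z) ≠ 0 := by rw [initCoords_smul]; exact smul_ne_zero ha hv
      have hH : Hyp (a • z) = Hyp z := by
        simp only [Hyp, initCoords_smul, PiLp.smul_apply, smul_eq_mul]
        rw [hyperplaneOffset_smul hK hneK, hyperplane_smul hv _ ha]
      simp only [F, if_neg hv, if_neg hav, hH]
  obtain ⟨f, hf⟩ := exists_continuousMap_projectivization F hFcont hFsmul
  refine ⟨f, fun k ⟨x, hx, hfx⟩ => ?_⟩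
  by_cases hpole : ∃ i, initCoords (x i).rep = 0
  · -- The value `q` is attained only at the point `[0 : 1]`, so there is at most one point.
    obtain ⟨i, hi⟩ := hpole
    have hall : ∀ j, initCoords (x j).rep = 0 := by
      intro j
      by_contra hj
      have h := hfx i j
      simp only [hf, F, if_pos hi, if_neg hj] at h
      exact hgint _ (hPmem hj).2 h.symm
    have hsub : ∀ j, j = i := by
      intro j
      refine hx (Projectivization.eq_of_rep_eq_smul
        (a := (x j).rep (Fin.last m) / (x i).rep (Fin.last m)) (eq_of_initCoords_eq ?_ ?_))
      · rw [initCoords_smul, hi, hall j, smul_zero]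
      · have : (x i).rep (Fin.last m) ≠ 0 := fun h =>
          (x i).rep_nonzero (eq_of_initCoords_eq (by rw [hi]; rfl) h)
        simp [this]
    obtain ⟨v, hv⟩ := exists_ne (0 : EuclideanSpace ℝ (Fin m))
    refine ⟨fun _ => hyperplane v (hyperplaneOffset K v 0),
      fun j j' _ => (hsub j).trans (hsub j').symm,
      fun _ => ⟨isAffineHyperplane_hyperplane hv _,
        hyperplane_hyperplaneOffset_inter_nonempty hconv hK hne hv 0⟩, fun _ _ => rfl⟩
  · push Not at hpole
    refine ⟨fun i => Hyp (x i).rep, fun i j hij => ?_,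
      fun i => ⟨isAffineHyperplane_hyperplane (hpole i) _, hmeet (hpole i)⟩, fun i j => ?_⟩
    · obtain ⟨a, ha, hv, ht⟩ := exists_smul_of_hyperplane_eq (hpole i) (hpole j) hij
      refine (hx (Projectivization.eq_of_rep_eq_smul (a := a) (eq_of_initCoords_eq ?_ ?_))).symm
      · rw [initCoords_smul, hv]
      · rw [hv, ← hyperplaneOffset_smul hK hneK] at ht
        simpa using hyperplaneOffset_injective hK hne (smul_ne_zero ha (hpole i)) ht
    · have h := hfx i j
      simp only [hf, F, if_neg (hpole i), if_neg (hpole j)] at h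
      exact hginj (hPmem (hpole i)).2 (hPmem (hpole j)).2 h

end Affine

end

theorem mainTheorem11 (m : ℕ) (hm : 1 ≤ m) (K : Set (EuclideanSpace ℝ (Fin m)))
    (hconv : Convex ℝ K) (hcomp : IsCompact K) (hint : (interior K).Nonempty) :
    (∃ f : C(RPOf (m + 1), UnitSphereOf (m + 1)), ∀ k : ℕ, AdmitsMultiplicity f k →
      ∃ H : Fin k → AffineSubspace ℝ (EuclideanSpace ℝ (Fin m)), Function.Injective H ∧
        (∀ i, IsAffineHyperplane (H i) ∧ ((H i : Set _) ∩ interior K).Nonempty) ∧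
        ∀ i j, sectionCentroid K (H i) = sectionCentroid K (H j)) ∧
    (∃ f : C(RPOf (m + 1), UnitSphereOf (m + 1)), ∀ k : ℕ, AdmitsMultiplicity f k →
      ∃ H : Fin k → AffineSubspace ℝ (EuclideanSpace ℝ (Fin m)), Function.Injective H ∧
        (∀ i, IsAffineHyperplane (H i) ∧ ((H i : Set _) ∩ interior K).Nonempty) ∧
        ∀ i j, sectionSteinerPoint K (H i) = sectionSteinerPoint K (H j)) ∧
    ((0 : EuclideanSpace ℝ (Fin m)) ∈ interior K →
      (∃ f : C(RPOf m, EuclideanSpace ℝ (Fin m)), ∀ k : ℕ, AdmitsMultiplicity f k →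
        ∃ H : Fin k → AffineSubspace ℝ (EuclideanSpace ℝ (Fin m)), Function.Injective H ∧
          (∀ i, IsLinearHyperplane (H i)) ∧
          ∀ i j, sectionCentroid K (H i) = sectionCentroid K (H j)) ∧
      (∃ f : C(RPOf m, EuclideanSpace ℝ (Fin m)), ∀ k : ℕ, AdmitsMultiplicity f k →
        ∃ H : Fin k → AffineSubspace ℝ (EuclideanSpace ℝ (Fin m)), Function.Injective H ∧
          (∀ i, IsLinearHyperplane (H i)) ∧
          ∀ i j, sectionSteinerPoint K (H i) = sectionSteinerPoint K (H j))) := by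
  have hC := isSectionPoint_sectionCentroid hconv hcomp
  have hS := isSectionPoint_sectionSteinerPoint hconv hcomp
  exact ⟨hC.exists_continuousMap_affine hm hconv hcomp hint,
    hS.exists_continuousMap_affine hm hconv hcomp hint,
    fun h0 => ⟨hC.exists_continuousMap_linear h0, hS.exists_continuousMap_linear h0⟩⟩
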